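/- **Definitions.** Let $(X,d)$ be a metric space and $p\in[1,\infty)$. $X$ has *Markov type $p$* if there is $M>0$ such that for every $n\in\mathbb N$, every stationary reversible Markov chain $\{Z_t\}_{t\ge 0}$ on $\{1,\dots,n\}$ (that is, a time-homogeneous chain whose transition matrix $P$ and initial distribution $\pi$ satisfy $\pi_iP_{ij}=\pi_jP_{ji}$ for all $i,j$), every map $f:\{1,\dots,n\}\to X$ and every $t\in\mathbb N$, $$\mathbb E\, d(f(Z_t),f(Z_0))^p\le M^p\,t\;\mathbb E\, d(f(Z_0),f(Z_1))^p .$$ $M_p(X)$ denotes the infimum of all such $M$. For a Lipschitz map $f$ between metric spaces, $\|f\|_{\mathrm{Lip}}$ denotes the infimal $L$ such that $f$ is $L$-Lipschitz. For $K>0$, $X$ *$K$-threshold-embeds* into a metric space $Y$ if there are Lipschitz maps $\varphi_\tau:X\to Y$ $(\tau>0)$ such that for all $\tau>0$ and $x,y\in X$, $$d_X(x,y)\ge\tau\ \Longrightarrow\ \|\varphi_\tau\|_{\mathrm{Lip}}>0\ \text{ and }\ d_Y(\varphi_\tau(x),\varphi_\tau(y))\ge\frac{\|\varphi_\tau\|_{\mathrm{Lip}}}{K}\,\tau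 .$$ $X$ *threshold-embeds* into $Y$ if it $K$-threshold-embeds into $Y$ for some $K>0$. For a real Banach space $Z$ and $\varepsilon>0$ let $$\rho_Z(\varepsilon)=\sup\Big\{\tfrac{\|x+\varepsilon y\|+\|x-\varepsilon y\|}{2}-1:\ x,y\in Z,\ \|x\|=\|y\|=1\Big\}$$ (with $\rho_Z(\varepsilon)=0$ if $Z=\{0\}$). $Z$ is *$p$-uniformly smooth* if there is $S>0$ with $\rho_Z(\varepsilon)\le S^p\varepsilon^p$ for all $\varepsilon>0$, and $S_p(Z)$ denotes the infimum of all such $S$. **Theorem.** 1. There is a universal constant $C>0$ such that the following holds for every $p\in(1,2]$, every $p$-uniformly smooth real Banach space $Z$ and every metric space $X$. If $X$ threshold-embeds into $Z$, then $X$ has Markov type $p$. Moreover, if $D>0$ and $X$ $D$-threshold-embeds into $Z$, then $$M_p(X)\le C\,D\,S_p(Z).$$ 2. There is a universal constant $C>0$ such that the following holds for every real Hilbert space $H$ and every metric space $X$. If $X$ threshold-embeds into $H$, then $X$ has Markov type $2$. Moreover, if $K>0$ and $X$ $K$-threshold-embeds into $H$, then $$M_2(X)\le C\,K.$$ -/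

import Mathlib

open MeasureTheory
open scoped NNReal

noncomputable section

/-- The process `Z₀, Z₁, …` on the probability space `(Ω, μ)` is a time-homogeneous Markov chain
on the state space `Fin n` with transition matrix `P` and initial distribution `π`, and `P` is
reversible with respect to `π`. Detailed balance makes `π` a stationary measure of the chain, so
`Z₀` is distributed according to a stationary measure. -/
structure IsStationaryReversibleChain {Ω : Type} [MeasurableSpace Ω] (μ : Measure Ω) {n : ℕ}
    (π : Fin n → ℝ) (P : Matrix (Fin n) (Fin n) ℝ) (Z : ℕ → Ω → Fin n) : Prop where
  measurable : ∀ t, Measurable (Z t)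
  initial_nonneg : ∀ i, 0 ≤ π i
  initial_sum : ∑ i, π i = 1
  transition_nonneg : ∀ i j, 0 ≤ P i j
  transition_sum : ∀ i, ∑ j, P i j = 1
  detailed_balance : ∀ i j, π i * P i j = π j * P j i
  law : ∀ (t : ℕ) (i : ℕ → Fin n),
    μ.real {ω | ∀ s ≤ t, Z s ω = i s} = π (i 0) * ∏ s ∈ Finset.range t, P (i s) (i (s + 1))

/-- The Markov type `p` inequality with constant `M`, for all stationary reversible Markov chains
on finite state spaces, all maps into `X` and all times. -/
def MarkovTypeIneq (p : ℝ) (X : Type*) [MetricSpace X] (M : ℝ) : Prop :=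
  ∀ (n : ℕ) (Ω : Type) [MeasurableSpace Ω] (μ : Measure Ω) [IsProbabilityMeasure μ]
    (π : Fin n → ℝ) (P : Matrix (Fin n) (Fin n) ℝ) (Z : ℕ → Ω → Fin n),
    IsStationaryReversibleChain μ π P Z →
    ∀ (f : Fin n → X) (t : ℕ),
      ∫ ω, dist (f (Z t ω)) (f (Z 0 ω)) ^ p ∂μ
        ≤ M ^ p * t * ∫ ω, dist (f (Z 0 ω)) (f (Z 1 ω)) ^ p ∂μ

/-- `X` has Markov type `p`. -/
def HasMarkovType (p : ℝ) (X : Type*) [MetricSpace X] : Prop :=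
  ∃ M : ℝ, 0 < M ∧ MarkovTypeIneq p X M

/-- The Markov type `p` constant `M_p(X)`. -/
def markovTypeConst (p : ℝ) (X : Type*) [MetricSpace X] : ℝ :=
  sInf {M : ℝ | 0 < M ∧ MarkovTypeIneq p X M}

/-- The Lipschitz constant `‖f‖_Lip` of a Lipschitz map: the infimal `L` such that `f` is
`L`-Lipschitz. -/
def lipConst {X Y : Type*} [MetricSpace X] [MetricSpace Y] (f : X → Y) : ℝ≥0 :=
  sInf {L : ℝ≥0 | LipschitzWith L f}

/-- `X` `K`-threshold-embeds into `Y`. The map at scale `τ` may have Lipschitz constant zero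
(that is, be constant) only if no two points of `X` are at distance at least `τ`; otherwise
constant maps would be threshold embeddings of every metric space. -/
def ThresholdEmbedsWith (K : ℝ) (X Y : Type*) [MetricSpace X] [MetricSpace Y] : Prop :=
  0 < K ∧ ∃ φ : ℝ → X → Y, ∀ τ : ℝ, 0 < τ →
    (∃ L : ℝ≥0, LipschitzWith L (φ τ)) ∧
    ∀ x y : X, τ ≤ dist x y →
      0 < lipConst (φ τ) ∧ (lipConst (φ τ) : ℝ) / K * τ ≤ dist (φ τ x) (φ τ y)

/-- `X` threshold-embeds into `Y`. -/
def ThresholdEmbeds (X Y : Type*) [MetricSpace X] [MetricSpace Y] : Prop :=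
  ∃ K : ℝ, ThresholdEmbedsWith K X Y

/-- The modulus of uniform smoothness `ρ_E(ε)`. -/
def smoothnessModulus (E : Type*) [NormedAddCommGroup E] [NormedSpace ℝ E] (ε : ℝ) : ℝ :=
  sSup {r : ℝ | ∃ x y : E, ‖x‖ = 1 ∧ ‖y‖ = 1 ∧ r = (‖x + ε • y‖ + ‖x - ε • y‖) / 2 - 1}

/-- `E` is `p`-uniformly smooth. -/
def IsPUniformlySmooth (p : ℝ) (E : Type*) [NormedAddCommGroup E] [NormedSpace ℝ E] : Prop :=
  ∃ S : ℝ, 0 < S ∧ ∀ ε : ℝ, 0 < ε → smoothnessModulus E ε ≤ S ^ p * ε ^ p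

/-- The `p`-uniform smoothness constant `S_p(E)`. -/
def smoothnessConst (p : ℝ) (E : Type*) [NormedAddCommGroup E] [NormedSpace ℝ E] : ℝ :=
  sInf {S : ℝ | 0 < S ∧ ∀ ε : ℝ, 0 < ε → smoothnessModulus E ε ≤ S ^ p * ε ^ p}

end

/-! A threshold embedding supplies, at each scale `2 ^ k`, a different map `g` into the smooth
space, normalized to be 1-Lipschitz. The `p`-th moment of the displacement therefore has to be
assembled from tails: up to a factor 4 it is the sum over `k` of `2 ^ (k p)` times the probability
of a displacement of at least `2 ^ k`. A plain `p`-th moment bound for each map would control every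
summand by the same quantity, and the sum over scales would diverge. The estimate at scale `k` must
be localized there.

At one scale, reversibility gives a forward-backward decomposition: `2 (g (z t) - g (z 0))` is a
martingale minus its time reversal, up to two boundary terms. The martingale is truncated at jumps
longer than `μ`, proportional to `2 ^ k`, and stopped once the accumulated conditional `p`-th
moments of the jumps exceed `b = μ ^ p`. Smoothness controls the `2p`-th moment of the result
(`IsReversible.pathExp_norm_sum_le`), and Chebyshev's inequality gives a tail bound in terms of `min
(a² / b) b`, where `a` is either the accumulated moment or the `p`-th power of a single jump
(`IsReversible.pathExp_chainMartingale_le`).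

This bound involves only distances in `X`, no longer the map `g`, so the scales can be added under
one expectation. For dyadic scales, `min (a² / b) b` sums to at most a constant times `a`, uniformly
in `p > 1` (`sum_capSq_le`). Stationarity then evaluates the remaining expectations as multiples of
the one-step moment. -/

/-! ### Smoothness of the norm and expansion of its `p`-th power -/

/-- The inequality `‖x + y‖ ≤ ‖x‖ + f y + 2 S^p ‖y‖^p` for a unit vector `x` and a functional `f`
norming it, which follows from `p`-uniform smoothness. -/
lemma norm_add_le_of_smoothnessModulus_le {E : Type*} [NormedAddCommGroup E] [NormedSpace ℝ E]
    {p S : ℝ} (hp : 1 < p)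
    (h : ∀ ε : ℝ, 0 < ε → smoothnessModulus E ε ≤ S ^ p * ε ^ p)
    (x y : E) (hx : ‖x‖ = 1) (f : E →L[ℝ] ℝ) (hf : ‖f‖ = 1) (hfx : f x = 1) :
    ‖x + y‖ ≤ 1 + f y + 2 * (S ^ p * ‖y‖ ^ p) := by
  by_cases hy : y = 0
  · simp [hy, hx, Real.zero_rpow (by linarith : p ≠ 0)]
  have hy0 : 0 < ‖y‖ := norm_pos_iff.mpr hy
  have h1 := h ‖y‖ hy0
  have hle : (‖x + y‖ + ‖x - y‖) / 2 - 1 ≤ smoothnessModulus E ‖y‖ := by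
    apply le_csSup
    · refine ⟨‖y‖, ?_⟩
      rintro r ⟨a, c, ha, hc, rfl⟩
      have e1 := norm_add_le a (‖y‖ • c)
      have e2 := norm_sub_le a (‖y‖ • c)
      rw [norm_smul, hc, norm_norm, ha] at e1 e2
      linarith
    · refine ⟨x, ‖y‖⁻¹ • y, hx, ?_, ?_⟩
      · rw [norm_smul, norm_inv, norm_norm, inv_mul_cancel₀ hy0.ne']
      · rw [smul_smul, mul_inv_cancel₀ hy0.ne', one_smul]
  -- The norming functional bounds `‖x - y‖` from below, which turns the symmetric modulus into a
  -- one-sided estimate.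
  have h2 : 1 - f y ≤ ‖x - y‖ := by
    have := f.le_opNorm (x - y)
    rw [hf, one_mul, map_sub, hfx] at this
    exact (le_abs_self _).trans this
  linarith

/-- A nonzero `p`-uniformly smooth space has smoothness constant bounded below. -/
lemma one_fourth_le_of_smoothnessModulus_le {E : Type*} [NormedAddCommGroup E] [NormedSpace ℝ E]
    [Nontrivial E] {p S : ℝ} (hp : p ≤ 2) (hS : 0 < S)
    (h : ∀ ε : ℝ, 0 < ε → smoothnessModulus E ε ≤ S ^ p * ε ^ p) : 1 / 4 ≤ S ^ p := by
  obtain ⟨x, hx⟩ := exists_norm_eq E (zero_le_one' ℝ)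
  -- Taking both unit vectors equal gives norms 3 and 1, whose average exceeds 1 by 1.
  have hle : (1 : ℝ) ≤ smoothnessModulus E 2 := by
    apply le_csSup
    · refine ⟨2, ?_⟩
      rintro r ⟨a, c, ha, hc, rfl⟩
      have e1 := norm_add_le a ((2 : ℝ) • c)
      have e2 := norm_sub_le a ((2 : ℝ) • c)
      rw [norm_smul, hc, ha] at e1 e2
      norm_num at e1 e2
      linarith
    · refine ⟨x, x, hx, hx, ?_⟩
      have e1 : x + (2 : ℝ) • x = (3 : ℝ) • x := by module
      have e2 : x - (2 : ℝ) • x = (-1 : ℝ) • x := by module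
      rw [e1, e2, norm_smul, norm_smul, hx]
      norm_num
  have h2 := h 2 (by norm_num)
  have h3 : (2 : ℝ) ^ p ≤ 4 := by
    calc (2 : ℝ) ^ p ≤ 2 ^ (2 : ℝ) := Real.rpow_le_rpow_of_exponent_le (by norm_num) hp
      _ = 4 := by norm_num
  have h4 : 0 < S ^ p := Real.rpow_pos_of_pos hS p
  nlinarith

/-- The tangent line of `w ↦ w ^ p` lies below it. -/
lemma rpow_add_mul_sub_le_rpow {p r w : ℝ} (hp : 1 < p) (hr : 0 < r) (hw : 0 ≤ w) :
    r ^ p + p * r ^ (p - 1) * (w - r) ≤ w ^ p := by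
  have h := one_add_mul_self_le_rpow_one_add (s := w / r - 1) (by
    have : 0 ≤ w / r := by positivity
    linarith) hp.le
  have e : r ^ p = r ^ (p - 1) * r := by
    rw [← Real.rpow_add_one hr.ne']; simp
  rw [add_sub_cancel, Real.div_rpow hw hr.le, le_div_iff₀ (by positivity)] at h
  calc r ^ p + p * r ^ (p - 1) * (w - r) = (1 + p * (w / r - 1)) * r ^ p := by
        rw [e]; field_simp
    _ ≤ w ^ p := h

/-- A second order estimate for `w ↦ w ^ p` at `1`. -/
lemma rpow_le_one_add_mul_sub_add {p w : ℝ} (hp : 1 < p) (hp2 : p ≤ 2) (hw : 0 ≤ w) :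
    w ^ p ≤ 1 + p * (w - 1) + 2 * |w - 1| ^ p := by
  rcases hw.eq_or_lt with rfl | hw
  · rw [Real.zero_rpow (by linarith)]; norm_num; linarith
  -- The tangent at `w`, evaluated at 1, leaves the error `p (w ^ (p - 1) - 1) (w - 1)`;
  -- subadditivity of `s ↦ s ^ (p - 1)` bounds it by `p |w - 1| ^ p`.
  have h1 := rpow_add_mul_sub_le_rpow hp hw zero_le_one
  rw [Real.one_rpow] at h1
  have e : |w - 1| ^ p = |w - 1| ^ (p - 1) * |w - 1| := by
    rcases eq_or_ne w 1 with rfl | hne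
    · simp [Real.zero_rpow (by linarith : p ≠ 0)]
    · rw [← Real.rpow_add_one (abs_ne_zero.mpr (sub_ne_zero.mpr hne))]; simp
  have sub : ∀ a c : ℝ, 0 ≤ c → c ≤ a → a ^ (p - 1) - c ^ (p - 1) ≤ (a - c) ^ (p - 1) := by
    intro a c hc hca
    have := Real.rpow_add_le_add_rpow hc (sub_nonneg.mpr hca) (by linarith : 0 ≤ p - 1)
      (by linarith)
    rw [add_sub_cancel] at this
    linarith
  have h2 : (w ^ (p - 1) - 1) * (w - 1) ≤ |w - 1| ^ p := by
    rw [e]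
    rcases le_total 1 w with h | h
    · have := sub w 1 zero_le_one h
      rw [Real.one_rpow] at this
      rw [abs_of_nonneg (sub_nonneg.mpr h)]
      exact mul_le_mul_of_nonneg_right this (sub_nonneg.mpr h)
    · have := sub 1 w hw.le h
      rw [Real.one_rpow] at this
      rw [abs_of_nonpos (sub_nonpos.mpr h), neg_sub]
      nlinarith
  have h3 : 0 ≤ |w - 1| ^ p := by positivity
  nlinarith

/-- The one-step expansion of `‖x + y‖ ^ p` that drives martingale inequalities in smooth
Banach spaces. -/
def HasSmoothExpansion (p B : ℝ) (E : Type*) [NormedAddCommGroup E] [NormedSpace ℝ E] : Prop :=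
  ∀ x : E, ∃ L : E →L[ℝ] ℝ, ∀ y : E,
    ‖x‖ ^ p + L y ≤ ‖x + y‖ ^ p ∧ ‖x + y‖ ^ p ≤ ‖x‖ ^ p + L y + B * ‖y‖ ^ p ∧
    L y ^ 2 ≤ 4 * (‖x‖ ^ p * ‖y‖ ^ p + (‖y‖ ^ p) ^ 2)

/-- If `r ≤ s`, the left side is at most `(s ^ p) ^ 2`. If `s ≤ r`, its ratio to `r ^ p * s ^ p` is
`(s / r) ^ (2 - p) ≤ 1`. -/
lemma rpow_sub_one_mul_sq_le {p r s : ℝ} (hp : 1 < p) (hp2 : p ≤ 2) (hr : 0 < r) (hs : 0 ≤ s) :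
    (r ^ (p - 1) * s) ^ 2 ≤ r ^ p * s ^ p + (s ^ p) ^ 2 := by
  rcases hs.eq_or_lt with rfl | hs
  · simp [Real.zero_rpow (by linarith : p ≠ 0)]
  rcases le_total r s with h | h
  · have h1 : r ^ (p - 1) * s ≤ s ^ p := by
      calc r ^ (p - 1) * s ≤ s ^ (p - 1) * s := by gcongr
        _ = s ^ p := by rw [← Real.rpow_add_one hs.ne']; simp
    have h2 : (r ^ (p - 1) * s) ^ 2 ≤ (s ^ p) ^ 2 := by gcongr
    have h3 : 0 ≤ r ^ p * s ^ p := by positivity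
    linarith
  · have e1 : (r ^ (p - 1) * s) ^ 2 = r ^ p * s ^ p * (s ^ (2 - p) * r ^ (p - 2)) := by
      have a1 : r ^ p * r ^ (p - 2) = (r ^ (p - 1)) ^ 2 := by
        rw [← Real.rpow_add hr, ← Real.rpow_mul_natCast hr.le]; congr 1; push_cast; ring
      have a2 : s ^ p * s ^ (2 - p) = s ^ 2 := by
        rw [← Real.rpow_add hs, ← Real.rpow_natCast]; congr 1; push_cast; ring
      rw [mul_pow, ← a1, ← a2]; ring
    have e2 : s ^ (2 - p) * r ^ (p - 2) ≤ 1 := by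
      calc s ^ (2 - p) * r ^ (p - 2) ≤ r ^ (2 - p) * r ^ (p - 2) := by gcongr
        _ = 1 := by rw [← Real.rpow_add hr]; simp
    rw [e1]
    have h3 : 0 ≤ r ^ p * s ^ p := by positivity
    nlinarith [sq_nonneg (s ^ p)]

/-- The linear term is `p ‖x‖ ^ (p - 1)` times a norming functional of `x`. After division by `‖x‖`,
small perturbations follow from smoothness and the second order estimate for powers, large ones from
the triangle inequality. -/
lemma hasSmoothExpansion_of_smoothnessModulus_le {E : Type*} [NormedAddCommGroup E]
    [NormedSpace ℝ E] {p S : ℝ} (hp : 1 < p) (hp2 : p ≤ 2) (hS4 : 1 / 4 ≤ S ^ p)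
    (h : ∀ ε : ℝ, 0 < ε → smoothnessModulus E ε ≤ S ^ p * ε ^ p) :
    HasSmoothExpansion p (24 * S ^ p) E := by
  intro x
  have hp0 : p ≠ 0 := by linarith
  by_cases hx : x = 0
  · refine ⟨0, fun y => ?_⟩
    have h1 : 0 ≤ ‖y‖ ^ p := by positivity
    simp only [hx, norm_zero, Real.zero_rpow hp0, zero_add, zero_apply, zero_mul]
    refine ⟨h1, by nlinarith, by norm_num; positivity⟩
  have hr : 0 < ‖x‖ := norm_pos_iff.mpr hx
  set r := ‖x‖ with hrdef
  obtain ⟨f, hf, hfx⟩ := exists_dual_vector ℝ x (norm_ne_zero_iff.mpr hx)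
  have hfx' : f x = r := by simpa using hfx
  have hfy : ∀ y, |f y| ≤ ‖y‖ := fun y => by
    have := f.le_opNorm y
    rwa [hf, one_mul] at this
  have er : r ^ p = r ^ (p - 1) * r := by
    rw [← Real.rpow_add_one hr.ne']; simp
  refine ⟨(p * r ^ (p - 1)) • f, fun y => ⟨?_, ?_, ?_⟩⟩
  · simp only [smul_apply, smul_eq_mul]
    have h1 : r + f y ≤ ‖x + y‖ := by
      rw [← hfx', ← map_add]; exact (le_abs_self _).trans (hfy _)
    have h2 := rpow_add_mul_sub_le_rpow hp hr (norm_nonneg (x + y))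
    have h3 : 0 ≤ p * r ^ (p - 1) := by positivity
    nlinarith
  · simp only [smul_apply, smul_eq_mul]
    set w := ‖x + y‖ / r with hw
    set ε := ‖y‖ / r with hε
    set v := f y / r with hv
    have hε0 : 0 ≤ ε := by positivity
    have hw0 : 0 ≤ w := by positivity
    have hvε : |v| ≤ ε := by
      rw [hv, abs_div, abs_of_pos hr]; exact div_le_div_of_nonneg_right (hfy y) hr.le
    have key : w ^ p ≤ 1 + p * v + 24 * S ^ p * ε ^ p := by
      have hw1 : w ≤ 1 + ε := by
        rw [hw, hε, div_le_iff₀ hr, add_mul, div_mul_cancel₀ _ hr.ne', one_mul]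
        exact norm_add_le x y
      have hw2 : 1 - ε ≤ w := by
        rw [hw, hε, le_div_iff₀ hr, sub_mul, div_mul_cancel₀ _ hr.ne', one_mul]
        have := norm_sub_norm_le x (-y)
        rw [norm_neg, sub_neg_eq_add] at this
        exact this
      obtain ⟨v1, v2⟩ := abs_le.mp hvε
      rcases le_total ε 1 with hε1 | hε1
      · have s1 := norm_add_le_of_smoothnessModulus_le hp h (r⁻¹ • x) (r⁻¹ • y)
          (by rw [norm_smul, norm_inv, Real.norm_of_nonneg hr.le]; exact inv_mul_cancel₀ hr.ne')
          f hf (by rw [map_smul, hfx', smul_eq_mul, inv_mul_cancel₀ hr.ne'])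
        rw [← smul_add, norm_smul, norm_smul, norm_inv, Real.norm_of_nonneg hr.le, map_smul,
          smul_eq_mul, inv_mul_eq_div, inv_mul_eq_div, inv_mul_eq_div, ← hw, ← hε, ← hv] at s1
        have s2 := rpow_le_one_add_mul_sub_add hp hp2 hw0
        have s3 : |w - 1| ^ p ≤ ε ^ p := by
          gcongr
          exact abs_le.mpr ⟨by linarith, by linarith⟩
        have s4 : 0 ≤ ε ^ p := by positivity
        have s5 : p * (w - 1) ≤ p * (v + 2 * (S ^ p * ε ^ p)) := by gcongr; linarith
        have s6 : 0 ≤ S ^ p * ε ^ p := by nlinarith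
        nlinarith
      -- This case fixes the constant 24: `24 * S ^ p ≥ 6` pays for `4 ε ^ p` and for `p v ≥ -2 ε ^
      -- p`.
      · have s1 : w ^ p ≤ 4 * ε ^ p := by
          calc w ^ p ≤ (2 * ε) ^ p := by gcongr; linarith
            _ = 2 ^ p * ε ^ p := Real.mul_rpow (by norm_num) hε0
            _ ≤ 2 ^ (2 : ℝ) * ε ^ p := by
              gcongr
              norm_num
            _ = 4 * ε ^ p := by norm_num
        have s2 : ε ≤ ε ^ p := Real.self_le_rpow_of_one_le hε1 hp.le
        nlinarith
    have e1 : ‖x + y‖ ^ p = r ^ p * w ^ p := by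
      rw [← Real.mul_rpow hr.le hw0, hw, mul_div_cancel₀ _ hr.ne']
    have e2 : ‖y‖ ^ p = r ^ p * ε ^ p := by
      rw [← Real.mul_rpow hr.le hε0, hε, mul_div_cancel₀ _ hr.ne']
    have e3 : p * r ^ (p - 1) * f y = r ^ p * (p * v) := by
      rw [er, hv]; field_simp
    rw [e1, e2, e3]
    have : 0 < r ^ p := by positivity
    nlinarith
  · simp only [smul_apply, smul_eq_mul]
    have h1 := rpow_sub_one_mul_sq_le hp hp2 hr (norm_nonneg y)
    have h2 : (f y) ^ 2 ≤ ‖y‖ ^ 2 := by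
      rw [← sq_abs (f y)]; gcongr; exact hfy y
    have h3 : p ^ 2 ≤ 4 := by nlinarith
    calc (p * r ^ (p - 1) * f y) ^ 2 = p ^ 2 * ((r ^ (p - 1)) ^ 2 * (f y) ^ 2) := by ring
      _ ≤ 4 * ((r ^ (p - 1)) ^ 2 * ‖y‖ ^ 2) := by gcongr
      _ = 4 * (r ^ (p - 1) * ‖y‖) ^ 2 := by ring
      _ ≤ _ := by gcongr

/-! ### Path expectations, stationarity and reversibility -/

/-- The weight of the path `z 0, …, z t`. -/
def pathWeight {n : ℕ} (π : Fin n → ℝ) (P : Matrix (Fin n) (Fin n) ℝ) (t : ℕ) (z : ℕ → Fin n) :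
    ℝ :=
  π (z 0) * ∏ s ∈ Finset.range t, P (z s) (z (s + 1))

/-- The path `x 0, …, x t`, frozen after time `t`. -/
def extendPath {n t : ℕ} (x : Fin (t + 1) → Fin n) (s : ℕ) : Fin n :=
  x ⟨min s t, by omega⟩

/-- The expectation of a functional of the path of the chain up to time `t`. -/
def pathExp {n : ℕ} (π : Fin n → ℝ) (P : Matrix (Fin n) (Fin n) ℝ) (t : ℕ)
    (G : (ℕ → Fin n) → ℝ) : ℝ :=
  ∑ x : Fin (t + 1) → Fin n, pathWeight π P t (extendPath x) * G (extendPath x)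

/-- The transition matrix `P` is reversible with respect to the probability vector `π`. -/
structure IsReversible {n : ℕ} (π : Fin n → ℝ) (P : Matrix (Fin n) (Fin n) ℝ) : Prop where
  initial_nonneg : ∀ i, 0 ≤ π i
  initial_sum : ∑ i, π i = 1
  transition_nonneg : ∀ i j, 0 ≤ P i j
  transition_sum : ∀ i, ∑ j, P i j = 1
  detailed_balance : ∀ i j, π i * P i j = π j * P j i

lemma IsStationaryReversibleChain.isReversible {Ω : Type} [MeasurableSpace Ω] {μ : Measure Ω}
    {n : ℕ} {π : Fin n → ℝ} {P : Matrix (Fin n) (Fin n) ℝ} {Z : ℕ → Ω → Fin n}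
    (h : IsStationaryReversibleChain μ π P Z) : IsReversible π P :=
  ⟨h.initial_nonneg, h.initial_sum, h.transition_nonneg, h.transition_sum, h.detailed_balance⟩

section

variable {n : ℕ} {π : Fin n → ℝ} {P : Matrix (Fin n) (Fin n) ℝ}

lemma extendPath_of_le {t : ℕ} (x : Fin (t + 1) → Fin n) {s : ℕ} (hs : s ≤ t) :
    extendPath x s = x ⟨s, by omega⟩ := by
  simp [extendPath, hs]

lemma extendPath_snoc_of_le {t : ℕ} (x : Fin (t + 1) → Fin n) (j : Fin n) {s : ℕ} (hs : s ≤ t) :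
    extendPath (Fin.snoc x j : Fin (t + 2) → Fin n) s = extendPath x s := by
  rw [extendPath_of_le _ hs, extendPath_of_le _ (by omega)]
  have : (⟨s, by omega⟩ : Fin (t + 2)) = Fin.castSucc ⟨s, by omega⟩ := rfl
  rw [this]
  exact Fin.snoc_castSucc (α := fun _ => Fin n) _ _ _

lemma extendPath_snoc_succ {t : ℕ} (x : Fin (t + 1) → Fin n) (j : Fin n) :
    extendPath (Fin.snoc x j : Fin (t + 2) → Fin n) (t + 1) = j := by
  rw [extendPath_of_le _ le_rfl]
  exact Fin.snoc_last (α := fun _ => Fin n) _ _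

lemma extendPath_rev {t : ℕ} (x : Fin (t + 1) → Fin n) :
    extendPath (x ∘ Fin.rev) = fun s => extendPath x (t - s) := by
  funext s
  simp only [extendPath, Function.comp]
  congr 1
  ext
  simp only [Fin.val_rev]
  omega

lemma IsReversible.pathWeight_nonneg (h : IsReversible π P) (t : ℕ) (z : ℕ → Fin n) :
    0 ≤ pathWeight π P t z :=
  mul_nonneg (h.initial_nonneg _) (Finset.prod_nonneg fun _ _ => h.transition_nonneg _ _)

lemma IsReversible.pathExp_mono (h : IsReversible π P) {t : ℕ} {G H : (ℕ → Fin n) → ℝ}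
    (hGH : ∀ z, G z ≤ H z) : pathExp π P t G ≤ pathExp π P t H :=
  Finset.sum_le_sum fun _ _ => mul_le_mul_of_nonneg_left (hGH _) (h.pathWeight_nonneg _ _)

lemma pathExp_add (t : ℕ) (G H : (ℕ → Fin n) → ℝ) :
    pathExp π P t (fun z => G z + H z) = pathExp π P t G + pathExp π P t H := by
  simp only [pathExp, mul_add, Finset.sum_add_distrib]

lemma pathExp_sub (t : ℕ) (G H : (ℕ → Fin n) → ℝ) :
    pathExp π P t (fun z => G z - H z) = pathExp π P t G - pathExp π P t H := by
  simp only [pathExp, mul_sub, Finset.sum_sub_distrib]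

lemma pathExp_const_mul (t : ℕ) (c : ℝ) (G : (ℕ → Fin n) → ℝ) :
    pathExp π P t (fun z => c * G z) = c * pathExp π P t G := by
  simp only [pathExp, Finset.mul_sum]
  exact Finset.sum_congr rfl fun _ _ => by ring

lemma pathExp_sum {ι : Type*} (t : ℕ) (F : Finset ι) (G : ι → (ℕ → Fin n) → ℝ) :
    pathExp π P t (fun z => ∑ k ∈ F, G k z) = ∑ k ∈ F, pathExp π P t (G k) := by
  simp only [pathExp, Finset.mul_sum]
  exact Finset.sum_comm

/-- The Markov property. -/
lemma pathExp_succ (t : ℕ) (H : (ℕ → Fin n) → Fin n → ℝ)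
    (hH : ∀ z z' j, (∀ s ≤ t, z s = z' s) → H z j = H z' j) :
    pathExp π P (t + 1) (fun z => H z (z (t + 1)))
      = pathExp π P t (fun z => ∑ j, P (z t) j * H z j) := by
  unfold pathExp
  rw [← (Fin.snocEquiv (fun _ : Fin (t + 2) => Fin n)).sum_comp, Fintype.sum_prod_type,
    Finset.sum_comm]
  refine Finset.sum_congr rfl fun x _ => ?_
  rw [Finset.mul_sum]
  refine Finset.sum_congr rfl fun j _ => ?_
  have e : (Fin.snocEquiv (fun _ : Fin (t + 2) => Fin n)) (j, x) = Fin.snoc x j := rfl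
  beta_reduce
  rw [e, extendPath_snoc_succ, hH _ (extendPath x) j fun s hs => extendPath_snoc_of_le x j hs,
    ← mul_assoc]
  congr 1
  unfold pathWeight
  rw [Finset.prod_range_succ, extendPath_snoc_succ, extendPath_snoc_of_le _ _ le_rfl,
    extendPath_snoc_of_le _ _ (Nat.zero_le _), ← mul_assoc]
  congr 2
  refine Finset.prod_congr rfl fun s hs => ?_
  have := Finset.mem_range.mp hs
  rw [extendPath_snoc_of_le _ _ (by omega), extendPath_snoc_of_le _ _ (by omega)]

/-- The rows of `P` sum to one, so averaging over an unseen step changes nothing. -/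
lemma IsReversible.pathExp_succ_of_dependsOn (h : IsReversible π P) (t : ℕ)
    (G : (ℕ → Fin n) → ℝ) (hG : ∀ z z', (∀ s ≤ t, z s = z' s) → G z = G z') :
    pathExp π P (t + 1) G = pathExp π P t G := by
  rw [pathExp_succ t (fun z _ => G z) fun z z' _ hz => hG z z' hz]
  simp only [← Finset.sum_mul, h.transition_sum, one_mul]

lemma pathExp_zero (G : (ℕ → Fin n) → ℝ) :
    pathExp π P 0 G = ∑ i, π i * G (fun _ => i) := by
  unfold pathExp pathWeight
  rw [← (Equiv.funUnique (Fin 1) (Fin n)).symm.sum_comp]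
  refine Finset.sum_congr rfl fun i _ => ?_
  have : extendPath (t := 0) ((Equiv.funUnique (Fin 1) (Fin n)).symm i) = fun _ => i := by
    funext s; simp [extendPath]
  rw [this]
  simp

lemma IsReversible.sum_mul_sum (h : IsReversible π P) (u : Fin n → ℝ) :
    ∑ i, π i * ∑ j, P i j * u j = ∑ i, π i * u i := by
  simp only [Finset.mul_sum, ← mul_assoc]
  rw [Finset.sum_comm]
  refine Finset.sum_congr rfl fun j _ => ?_
  simp only [h.detailed_balance _ j, ← Finset.sum_mul, ← Finset.mul_sum, h.transition_sum, mul_one]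

/-- Stationarity. -/
lemma IsReversible.pathExp_apply (h : IsReversible π P) (t : ℕ) (u : Fin n → ℝ) {s : ℕ}
    (hs : s ≤ t) : pathExp π P t (fun z => u (z s)) = ∑ i, π i * u i := by
  have last : ∀ (t : ℕ) (u : Fin n → ℝ),
      pathExp π P t (fun z => u (z t)) = ∑ i, π i * u i := by
    intro t
    induction t with
    | zero => intro u; rw [pathExp_zero]
    | succ t ih =>
      intro u
      rw [pathExp_succ t (fun _ j => u j) fun _ _ _ _ => rfl,
        ih (fun i => ∑ j, P i j * u j), h.sum_mul_sum]
  induction t, hs using Nat.le_induction with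
  | base => exact last s u
  | succ t hst ih =>
    rw [h.pathExp_succ_of_dependsOn t _ fun z z' hz => by rw [hz s hst], ih]

lemma IsReversible.pathExp_apply_step (h : IsReversible π P) (t : ℕ) (u : Fin n → Fin n → ℝ)
    {s : ℕ} (hs : s < t) :
    pathExp π P t (fun z => u (z s) (z (s + 1))) = ∑ i, π i * ∑ j, P i j * u i j := by
  induction t, hs using Nat.le_induction with
  | base =>
    rw [pathExp_succ s (fun z j => u (z s) j) fun z z' j hz => by rw [hz s le_rfl],
      h.pathExp_apply s (fun i => ∑ j, P i j * u i j) le_rfl]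
  | succ t hst ih =>
    rw [h.pathExp_succ_of_dependsOn t _ fun z z' hz => by
      rw [hz s (by omega), hz (s + 1) (by omega)], ih]

/-- Detailed balance carries the factor `π` along the path one edge at a time, so the weight can
equally be read from the endpoint. -/
lemma IsReversible.pathWeight_reverse (h : IsReversible π P) (t : ℕ) (z : ℕ → Fin n) :
    pathWeight π P t (fun s => z (t - s)) = pathWeight π P t z := by
  have aux : ∀ t, pathWeight π P t z
      = π (z t) * ∏ s ∈ Finset.range t, P (z (s + 1)) (z s) := by
    intro t
    induction t with
    | zero => simp [pathWeight]
    | succ t ih =>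
      have e : pathWeight π P (t + 1) z = pathWeight π P t z * P (z t) (z (t + 1)) := by
        simp [pathWeight, Finset.prod_range_succ, mul_assoc]
      rw [e, ih, Finset.prod_range_succ, mul_right_comm, h.detailed_balance]
      ring
  rw [aux, pathWeight, ← Finset.prod_range_reflect (fun s => P (z (s + 1)) (z s)) t, Nat.sub_zero]
  congr 1
  refine Finset.prod_congr rfl fun s hs => ?_
  have := Finset.mem_range.mp hs
  have e1 : t - 1 - s + 1 = t - s := by omega
  have e2 : t - 1 - s = t - (s + 1) := by omega
  rw [e1, e2]

/-- Reversibility: the law of the chain is invariant under time reversal. -/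
lemma IsReversible.pathExp_reverse (h : IsReversible π P) (t : ℕ) (G : (ℕ → Fin n) → ℝ) :
    pathExp π P t (fun z => G (fun s => z (t - s))) = pathExp π P t G := by
  unfold pathExp
  conv_rhs => rw [← (Equiv.arrowCongr Fin.revPerm (Equiv.refl (Fin n))).sum_comp]
  refine Finset.sum_congr rfl fun x _ => ?_
  have e : (Equiv.arrowCongr Fin.revPerm (Equiv.refl (Fin n))) x = x ∘ Fin.rev := rfl
  rw [e, extendPath_rev, h.pathWeight_reverse]

end

/-- The expectation of a functional of a finite portion of the chain. -/
lemma IsStationaryReversibleChain.integral_eq_pathExp {Ω : Type} [MeasurableSpace Ω]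
    {μ : Measure Ω} [IsProbabilityMeasure μ] {n : ℕ} {π : Fin n → ℝ}
    {P : Matrix (Fin n) (Fin n) ℝ} {Z : ℕ → Ω → Fin n}
    (h : IsStationaryReversibleChain μ π P Z) (t : ℕ) (G : (ℕ → Fin n) → ℝ)
    (hG : ∀ z z', (∀ s ≤ t, z s = z' s) → G z = G z') :
    ∫ ω, G (fun s => Z s ω) ∂μ = pathExp π P t G := by
  set R : Ω → (Fin (t + 1) → Fin n) := fun ω s => Z s ω with hR
  have hRm : Measurable R := measurable_pi_lambda _ fun s => h.measurable s
  have e1 : ∀ ω, G (fun s => Z s ω) = (fun x => G (extendPath x)) (R ω) := fun ω =>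
    hG _ _ fun s hs => by rw [extendPath_of_le _ hs]
  have hprob : IsProbabilityMeasure (μ.map R) := Measure.isProbabilityMeasure_map hRm.aemeasurable
  simp_rw [e1]
  rw [← integral_map (f := fun x => G (extendPath x)) hRm.aemeasurable
      (measurable_of_finite _).aestronglyMeasurable,
    integral_fintype Integrable.of_finite]
  refine Finset.sum_congr rfl fun x _ => ?_
  rw [smul_eq_mul]
  congr 1
  rw [map_measureReal_apply hRm (measurableSet_singleton x), pathWeight, ← h.law]
  congr 1
  ext ω
  simp only [Set.mem_preimage, Set.mem_singleton_iff, Set.mem_ofPred_eq, hR]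
  constructor
  · rintro rfl s hs
    rw [extendPath_of_le _ hs]
  · intro hx
    funext s
    rw [hx s (by omega), extendPath_of_le _ (by omega)]

/-! ### The `2p`-th moment of a martingale transform -/

/-- One step of a supermartingale: with `A` the accumulated conditional moments and `R` the
accumulated squares, the process `‖M‖ ^ (2p) - 10 B ‖M‖ ^ p A - 10 B² R` decreases on average. The
new moment is already included in `A`, and this compensates the expected growth of the square. -/
lemma HasSmoothExpansion.sum_mul_le {E : Type*} [NormedAddCommGroup E] [NormedSpace ℝ E]
    {p B : ℝ} (hE : HasSmoothExpansion p B E) (hB : 1 ≤ B) {n : ℕ} {w : Fin n → ℝ}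
    (hw : ∀ j, 0 ≤ w j) (hw1 : ∑ j, w j = 1) {D : Fin n → E} (hD : ∑ j, w j • D j = 0)
    (x : E) {A : ℝ} (hA : 0 ≤ A) (R : ℝ) :
    ∑ j, w j * ((‖x + D j‖ ^ p) ^ 2 - 10 * B * (‖x + D j‖ ^ p * (A + ∑ k, w k * ‖D k‖ ^ p))
        - 10 * B ^ 2 * (R + (‖D j‖ ^ p) ^ 2))
      ≤ (‖x‖ ^ p) ^ 2 - 10 * B * (‖x‖ ^ p * A) - 10 * B ^ 2 * R := by
  obtain ⟨L, hL⟩ := hE x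
  set η := ∑ k, w k * ‖D k‖ ^ p with hη
  set Y := ‖x‖ ^ p with hY
  have hY0 : 0 ≤ Y := by positivity
  have hη0 : 0 ≤ η := Finset.sum_nonneg fun k _ => mul_nonneg (hw k) (by positivity)
  have hLD : ∑ j, w j * L (D j) = 0 := by
    have := congrArg L hD
    simpa only [map_sum, map_smul, smul_eq_mul, map_zero] using this
  have step : ∀ j, (‖x + D j‖ ^ p) ^ 2 - 10 * B * (‖x + D j‖ ^ p * (A + η))
      - 10 * B ^ 2 * (R + (‖D j‖ ^ p) ^ 2)
      ≤ (Y ^ 2 - 10 * B * (Y * (A + η)) - 10 * B ^ 2 * R)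
        + (2 * Y - 10 * B * (A + η)) * L (D j) + 10 * B * Y * ‖D j‖ ^ p := by
    intro j
    obtain ⟨h1, h2, h3⟩ := hL (D j)
    set δ := ‖D j‖ ^ p
    set V := ‖x + D j‖ ^ p
    set l := L (D j)
    have hδ : 0 ≤ δ := by positivity
    have hV : 0 ≤ V := by positivity
    have a1 : V ^ 2 ≤ (Y + l + B * δ) ^ 2 := by gcongr
    -- The mixed term enters with a negative sign, so it needs the lower bound of the expansion.
    have a2 : (Y + l) * (10 * B * (A + η)) ≤ V * (10 * B * (A + η)) := by gcongr
    have a3 : (Y + l + B * δ) ^ 2 ≤ Y ^ 2 + 2 * Y * l + 2 * Y * (B * δ) + 2 * l ^ 2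
        + 2 * (B * δ) ^ 2 := by nlinarith [sq_nonneg (l - B * δ)]
    -- Both constants 10 arise as 2 + 8: 2 from the terms with `B * δ`, 8 from `2 * l ^ 2`.
    have a4 : 8 * (Y * δ) ≤ 8 * (B * (Y * δ)) := by
      have : 0 ≤ Y * δ := by positivity
      nlinarith
    have a5 : 8 * δ ^ 2 ≤ 8 * (B ^ 2 * δ ^ 2) := by
      have : 0 ≤ δ ^ 2 := by positivity
      have : 1 ≤ B ^ 2 := by nlinarith
      nlinarith
    nlinarith
  calc _ ≤ ∑ j, w j * ((Y ^ 2 - 10 * B * (Y * (A + η)) - 10 * B ^ 2 * R)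
        + (2 * Y - 10 * B * (A + η)) * L (D j) + 10 * B * Y * ‖D j‖ ^ p) :=
        Finset.sum_le_sum fun j _ => mul_le_mul_of_nonneg_left (step j) (hw j)
    _ = (∑ j, w j) * (Y ^ 2 - 10 * B * (Y * (A + η)) - 10 * B ^ 2 * R)
        + (2 * Y - 10 * B * (A + η)) * (∑ j, w j * L (D j)) + 10 * B * Y * η := by
        rw [hη, Finset.sum_mul, Finset.mul_sum, Finset.mul_sum, ← Finset.sum_add_distrib,
          ← Finset.sum_add_distrib]
        exact Finset.sum_congr rfl fun j _ => by ring
    _ = Y ^ 2 - 10 * B * (Y * A) - 10 * B ^ 2 * R := by rw [hw1, hLD]; ring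

/-- A `2p`-th moment estimate for martingale transforms along a reversible chain. -/
lemma IsReversible.pathExp_norm_sum_le {E : Type*} [NormedAddCommGroup E] [NormedSpace ℝ E]
    {p B : ℝ} (hp : 1 < p) (hE : HasSmoothExpansion p B E) (hB : 1 ≤ B) {n : ℕ} {π : Fin n → ℝ}
    {P : Matrix (Fin n) (Fin n) ℝ} (h : IsReversible π P) (D : Fin n → Fin n → E)
    (hD : ∀ i, ∑ j, P i j • D i j = 0) (χ : ℕ → (ℕ → Fin n) → ℝ)
    (hχ : ∀ s z, χ s z = 0 ∨ χ s z = 1)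
    (hχd : ∀ s z z', (∀ u ≤ s, z u = z' u) → χ s z = χ s z') (t : ℕ) :
    pathExp π P t (fun z => (‖∑ u ∈ Finset.range t, χ u z • D (z u) (z (u + 1))‖ ^ p) ^ 2)
      ≤ pathExp π P t (fun z =>
        100 * B ^ 2 * (∑ u ∈ Finset.range t, χ u z * ∑ j, P (z u) j * ‖D (z u) j‖ ^ p) ^ 2
        + 20 * B ^ 2 *
          ∑ u ∈ Finset.range t, χ u z * (‖D (z u) (z (u + 1))‖ ^ p) ^ 2) := by
  set M : ℕ → (ℕ → Fin n) → E := fun s z =>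
    ∑ u ∈ Finset.range s, χ u z • D (z u) (z (u + 1)) with hM
  set A : ℕ → (ℕ → Fin n) → ℝ := fun s z =>
    ∑ u ∈ Finset.range s, χ u z * ∑ j, P (z u) j * ‖D (z u) j‖ ^ p with hA
  set R : ℕ → (ℕ → Fin n) → ℝ := fun s z =>
    ∑ u ∈ Finset.range s, χ u z * (‖D (z u) (z (u + 1))‖ ^ p) ^ 2 with hR
  have hχ0 : ∀ s z, 0 ≤ χ s z := fun s z => by rcases hχ s z with e | e <;> simp [e]
  have hA0 : ∀ s z, 0 ≤ A s z := fun s z => Finset.sum_nonneg fun u _ =>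
    mul_nonneg (hχ0 _ _) (Finset.sum_nonneg fun j _ =>
      mul_nonneg (h.transition_nonneg _ _) (by positivity))
  have super : ∀ s, pathExp π P s (fun z =>
      (‖M s z‖ ^ p) ^ 2 - 10 * B * (‖M s z‖ ^ p * A s z) - 10 * B ^ 2 * R s z) ≤ 0 := by
    intro s
    induction s with
    | zero =>
      rw [pathExp_zero]
      simp [hM, hA, hR, Real.zero_rpow (by linarith : p ≠ 0)]
    | succ s ih =>
      refine le_trans ?_ ih
      have e := pathExp_succ (π := π) (P := P) s (fun z j =>
        (‖M s z + χ s z • D (z s) j‖ ^ p) ^ 2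
        - 10 * B * (‖M s z + χ s z • D (z s) j‖ ^ p *
            (A s z + χ s z * ∑ j, P (z s) j * ‖D (z s) j‖ ^ p))
        - 10 * B ^ 2 * (R s z + χ s z * (‖D (z s) j‖ ^ p) ^ 2)) (by
          intro z z' j hz
          have c : ∀ u ∈ Finset.range s, χ u z = χ u z' ∧ z u = z' u ∧ z (u + 1) = z' (u + 1) :=
            fun u hu => by
              have := Finset.mem_range.mp hu
              exact ⟨hχd u z z' fun v hv => hz v (by omega), hz u (by omega), hz _ (by omega)⟩
          have c1 : M s z = M s z' := Finset.sum_congr rfl fun u hu => by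
            obtain ⟨a1, a2, a3⟩ := c u hu; rw [a1, a2, a3]
          have c2 : A s z = A s z' := Finset.sum_congr rfl fun u hu => by
            obtain ⟨a1, a2, a3⟩ := c u hu; rw [a1, a2]
          have c3 : R s z = R s z' := Finset.sum_congr rfl fun u hu => by
            obtain ⟨a1, a2, a3⟩ := c u hu; rw [a1, a2, a3]
          rw [c1, c2, c3, hχd s z z' hz, hz s le_rfl])
      have eM : ∀ z, M (s + 1) z = M s z + χ s z • D (z s) (z (s + 1)) := fun z =>
        Finset.sum_range_succ _ _
      have eA : ∀ z, A (s + 1) z = A s z + χ s z * ∑ j, P (z s) j * ‖D (z s) j‖ ^ p := fun z =>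
        Finset.sum_range_succ _ _
      have eR : ∀ z, R (s + 1) z = R s z + χ s z * (‖D (z s) (z (s + 1))‖ ^ p) ^ 2 := fun z =>
        Finset.sum_range_succ _ _
      simp only [eM, eA, eR]
      rw [e]
      refine h.pathExp_mono fun z => ?_
      -- Where the transform vanishes the process is frozen; elsewhere the one-step inequality
      -- applies.
      rcases hχ s z with hz | hz
      · simp only [hz, zero_smul, zero_mul, add_zero]
        rw [← Finset.sum_mul, h.transition_sum, one_mul]
      · simp only [hz, one_smul, one_mul]
        exact hE.sum_mul_le hB (h.transition_nonneg _) (h.transition_sum _) (hD _) _ (hA0 s z) _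
  have s1 := super t
  -- Completing the square in `‖M‖ ^ p - 10 B A` absorbs the mixed term.
  have s2 : pathExp π P t (fun z => (‖M t z‖ ^ p) ^ 2
      - (100 * B ^ 2 * A t z ^ 2 + 20 * B ^ 2 * R t z))
      ≤ 2 * pathExp π P t (fun z =>
        (‖M t z‖ ^ p) ^ 2 - 10 * B * (‖M t z‖ ^ p * A t z) - 10 * B ^ 2 * R t z) := by
    rw [← pathExp_const_mul]
    refine h.pathExp_mono fun z => ?_
    nlinarith [sq_nonneg (‖M t z‖ ^ p - 10 * B * A t z)]
  rw [pathExp_sub] at s2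
  linarith

/-! ### Truncation, stopping and the martingale tail at one scale -/

/-- The truncated quadratic function `min (a² / b) b`. -/
noncomputable def capSq (b a : ℝ) : ℝ := min (a ^ 2 / b) b

lemma capSq_nonneg {b : ℝ} (hb : 0 < b) (a : ℝ) : 0 ≤ capSq b a :=
  le_min (by positivity) hb.le

lemma capSq_eq_of_le {b a : ℝ} (hb : 0 < b) (h : b ≤ a) : capSq b a = b :=
  min_eq_right (by rw [le_div_iff₀ hb]; nlinarith)

/-- Since `b * capSq b a` is `min (a ^ 2) (b ^ 2)`, this converts squares of truncated or stopped
quantities into `capSq`. -/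
lemma sq_le_mul_capSq {b a s : ℝ} (hb : 0 < b) (hs : 0 ≤ s) (hsa : s ≤ a) (hsb : s ≤ b) :
    s ^ 2 ≤ b * capSq b a := by
  rw [capSq, mul_min_of_nonneg _ _ hb.le, mul_div_cancel₀ _ hb.ne']
  exact le_min (by gcongr) (by nlinarith)

lemma add_rpow_le_four_mul {p x y : ℝ} (hp : 1 < p) (hp2 : p ≤ 2) (hx : 0 ≤ x) (hy : 0 ≤ y) :
    (x + y) ^ p ≤ 4 * (x ^ p + y ^ p) := by
  have h2 : (2 : ℝ) ^ p ≤ 4 := by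
    calc (2 : ℝ) ^ p ≤ 2 ^ (2 : ℝ) := Real.rpow_le_rpow_of_exponent_le (by norm_num) hp2
      _ = 4 := by norm_num
  have key : ∀ m : ℝ, 0 ≤ m → (2 * m) ^ p ≤ 4 * m ^ p := fun m hm => by
    rw [Real.mul_rpow (by norm_num) hm]; gcongr
  have hxp : 0 ≤ x ^ p := by positivity
  have hyp : 0 ≤ y ^ p := by positivity
  rcases le_total x y with h | h
  · have : (x + y) ^ p ≤ (2 * y) ^ p := by gcongr; linarith
    linarith [key y hy]
  · have : (x + y) ^ p ≤ (2 * x) ^ p := by gcongr; linarith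
    linarith [key x hx]

/-- The martingale part of `g (z t) - g (z 0)` for the chain with transition matrix `P`. -/
def chainMartingale {E : Type*} [NormedAddCommGroup E] [NormedSpace ℝ E] {n : ℕ}
    (P : Matrix (Fin n) (Fin n) ℝ) (g : Fin n → E) (t : ℕ) (z : ℕ → Fin n) : E :=
  ∑ s ∈ Finset.range t, (g (z (s + 1)) - ∑ k, P (z s) k • g k)

/-- The conditional `p`-th moment of one step of the chain. -/
noncomputable def stepMoment {n : ℕ} (P : Matrix (Fin n) (Fin n) ℝ) (d : Fin n → Fin n → ℝ)
    (p : ℝ) (i : Fin n) : ℝ :=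
  ∑ j, P i j * d i j ^ p

section

variable {E : Type*} [NormedAddCommGroup E] [NormedSpace ℝ E] {p B : ℝ} {n : ℕ} {π : Fin n → ℝ}
  {P : Matrix (Fin n) (Fin n) ℝ}

lemma IsReversible.stepMoment_nonneg (h : IsReversible π P) {d : Fin n → Fin n → ℝ}
    (hd : ∀ i j, 0 ≤ d i j) (i : Fin n) : 0 ≤ stepMoment P d p i :=
  Finset.sum_nonneg fun j _ =>
    mul_nonneg (h.transition_nonneg _ _) (Real.rpow_nonneg (hd i j) _)

/-- The increment of a function along the chain, set to zero on jumps longer than `μ`. -/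
noncomputable def truncIncr (d : Fin n → Fin n → ℝ) (μ : ℝ) (g : Fin n → E) (i j : Fin n) : E :=
  if d i j ≤ μ then g j - g i else 0

/-- The length of a jump, set to zero when it exceeds `μ`. -/
noncomputable def truncDist (d : Fin n → Fin n → ℝ) (μ : ℝ) (i j : Fin n) : ℝ :=
  if d i j ≤ μ then d i j else 0

/-- The compensated truncated increment. -/
noncomputable def truncDiff (P : Matrix (Fin n) (Fin n) ℝ) (d : Fin n → Fin n → ℝ) (μ : ℝ)
    (g : Fin n → E) (i j : Fin n) : E :=
  truncIncr d μ g i j - ∑ k, P i k • truncIncr d μ g i k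

lemma IsReversible.sum_smul_truncDiff (h : IsReversible π P) (d : Fin n → Fin n → ℝ) (μ : ℝ)
    (g : Fin n → E) (i : Fin n) : ∑ j, P i j • truncDiff P d μ g i j = 0 := by
  simp only [truncDiff, smul_sub, Finset.sum_sub_distrib, ← Finset.sum_smul, h.transition_sum,
    one_smul, sub_self]

lemma truncDist_nonneg {d : Fin n → Fin n → ℝ} (hd : ∀ i j, 0 ≤ d i j) (μ : ℝ) (i j : Fin n) :
    0 ≤ truncDist d μ i j := by
  unfold truncDist; split_ifs; exacts [hd i j, le_rfl]

lemma truncDist_le {d : Fin n → Fin n → ℝ} (hd : ∀ i j, 0 ≤ d i j) (μ : ℝ) (i j : Fin n) :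
    truncDist d μ i j ≤ d i j := by
  unfold truncDist; split_ifs; exacts [le_rfl, hd i j]

lemma truncDist_le' (d : Fin n → Fin n → ℝ) {μ : ℝ} (hμ : 0 ≤ μ) (i j : Fin n) :
    truncDist d μ i j ≤ μ := by
  unfold truncDist; split_ifs with h; exacts [h, hμ]

/-- The `p`-th power of a compensated truncated increment. -/
lemma IsReversible.norm_truncDiff_rpow_le (hp : 1 < p) (hp2 : p ≤ 2) (h : IsReversible π P)
    {d : Fin n → Fin n → ℝ} (hd : ∀ i j, 0 ≤ d i j) {g : Fin n → E}
    (hg : ∀ i j, ‖g j - g i‖ ≤ d i j) (μ : ℝ) (i j : Fin n) :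
    ‖truncDiff P d μ g i j‖ ^ p ≤ 4 * (truncDist d μ i j ^ p + stepMoment P d p i) := by
  have h1 : ∀ k, ‖truncIncr d μ g i k‖ ≤ truncDist d μ i k := fun k => by
    unfold truncIncr truncDist; split_ifs; exacts [hg i k, norm_zero.le]
  have h2 : ‖∑ k, P i k • truncIncr d μ g i k‖ ≤ ∑ k, P i k * truncDist d μ i k := by
    refine (norm_sum_le _ _).trans (Finset.sum_le_sum fun k _ => ?_)
    rw [norm_smul, Real.norm_of_nonneg (h.transition_nonneg _ _)]
    exact mul_le_mul_of_nonneg_left (h1 k) (h.transition_nonneg _ _)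
  have h0 := truncDist_nonneg hd μ
  have h3 : (∑ k, P i k * truncDist d μ i k) ^ p ≤ stepMoment P d p i :=
    (Real.rpow_arith_mean_le_arith_mean_rpow Finset.univ _ _
      (fun k _ => h.transition_nonneg i k) (h.transition_sum i) (fun k _ => h0 i k) hp.le).trans
      (Finset.sum_le_sum fun k _ => mul_le_mul_of_nonneg_left
        (Real.rpow_le_rpow (h0 i k) (truncDist_le hd μ i k) (by linarith))
        (h.transition_nonneg i k))
  have h4 : 0 ≤ ∑ k, P i k * truncDist d μ i k :=
    Finset.sum_nonneg fun k _ => mul_nonneg (h.transition_nonneg _ _) (h0 i k)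
  calc ‖truncDiff P d μ g i j‖ ^ p
      ≤ (truncDist d μ i j + ∑ k, P i k * truncDist d μ i k) ^ p := by
        gcongr
        exact (norm_sub_le _ _).trans (add_le_add (h1 j) h2)
    _ ≤ 4 * (truncDist d μ i j ^ p + (∑ k, P i k * truncDist d μ i k) ^ p) :=
        add_rpow_le_four_mul hp hp2 (h0 i j) h4
    _ ≤ _ := by gcongr

lemma IsReversible.sum_norm_truncDiff_rpow_le (hp : 1 < p) (hp2 : p ≤ 2) (h : IsReversible π P)
    {d : Fin n → Fin n → ℝ} (hd : ∀ i j, 0 ≤ d i j) {g : Fin n → E}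
    (hg : ∀ i j, ‖g j - g i‖ ≤ d i j) (μ : ℝ) (i : Fin n) :
    ∑ j, P i j * ‖truncDiff P d μ g i j‖ ^ p ≤ 8 * stepMoment P d p i := by
  calc ∑ j, P i j * ‖truncDiff P d μ g i j‖ ^ p
      ≤ ∑ j, P i j * (4 * (d i j ^ p + stepMoment P d p i)) := by
        refine Finset.sum_le_sum fun j _ => mul_le_mul_of_nonneg_left
          ((h.norm_truncDiff_rpow_le hp hp2 hd hg μ i j).trans ?_) (h.transition_nonneg i j)
        have := Real.rpow_le_rpow (truncDist_nonneg hd μ i j) (truncDist_le hd μ i j)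
          (by linarith : 0 ≤ p)
        linarith
    _ = 4 * ∑ j, P i j * d i j ^ p + 4 * ((∑ j, P i j) * stepMoment P d p i) := by
        rw [Finset.sum_mul, Finset.mul_sum, Finset.mul_sum, ← Finset.sum_add_distrib]
        exact Finset.sum_congr rfl fun j _ => by ring
    _ = 8 * stepMoment P d p i := by rw [h.transition_sum, stepMoment]; ring

/-- Short jumps contribute nearly the same to the martingale part before and after truncation. -/
lemma IsReversible.norm_sub_truncDiff_le (hp : 1 < p) (h : IsReversible π P)
    {d : Fin n → Fin n → ℝ} (hd : ∀ i j, 0 ≤ d i j) {g : Fin n → E}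
    (hg : ∀ i j, ‖g j - g i‖ ≤ d i j) {μ : ℝ} (hμ : 0 < μ) {i j : Fin n} (hij : d i j ≤ μ) :
    ‖(g j - ∑ k, P i k • g k) - truncDiff P d μ g i j‖ ≤ μ / μ ^ p * stepMoment P d p i := by
  have e : (g j - ∑ k, P i k • g k) - truncDiff P d μ g i j
      = -∑ k, P i k • ((g k - g i) - truncIncr d μ g i k) := by
    simp only [smul_sub, Finset.sum_sub_distrib, ← Finset.sum_smul, h.transition_sum, one_smul,
      truncDiff]
    rw [show truncIncr d μ g i j = g j - g i from if_pos hij]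
    abel
  rw [e, norm_neg, stepMoment, Finset.mul_sum]
  refine (norm_sum_le _ _).trans (Finset.sum_le_sum fun k _ => ?_)
  rw [norm_smul, Real.norm_of_nonneg (h.transition_nonneg _ _), mul_left_comm]
  refine mul_le_mul_of_nonneg_left ?_ (h.transition_nonneg _ _)
  unfold truncIncr
  split_ifs with hk
  · rw [sub_self, norm_zero]
    have := hd i k
    positivity
  · rw [sub_zero]
    refine (hg i k).trans ?_
    have h1 : d i k / μ ≤ (d i k / μ) ^ p :=
      Real.self_le_rpow_of_one_le (by rw [le_div_iff₀ hμ]; linarith) hp.le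
    rw [Real.div_rpow (hd i k) hμ.le, div_le_iff₀ hμ] at h1
    calc d i k ≤ d i k ^ p / μ ^ p * μ := h1
      _ = μ / μ ^ p * d i k ^ p := by ring

/-- The transform stopping the martingale once the accumulated moments exceed `b`. -/
noncomputable def stopFactor (c : Fin n → ℝ) (b : ℝ) (s : ℕ) (z : ℕ → Fin n) : ℝ :=
  if ∑ u ∈ Finset.range (s + 1), c (z u) ≤ b then 1 else 0

/-- The factor at time `s` already counts the term `c (z s)`, so the last admitted term cannot push
the stopped sum past `b`. -/
lemma sum_stopFactor_mul_le {c : Fin n → ℝ} (hc : ∀ i, 0 ≤ c i) {b : ℝ} (hb : 0 ≤ b) (t : ℕ)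
    (z : ℕ → Fin n) :
    ∑ s ∈ Finset.range t, stopFactor c b s z * c (z s) ≤ ∑ s ∈ Finset.range t, c (z s) ∧
    ∑ s ∈ Finset.range t, stopFactor c b s z * c (z s) ≤ b := by
  have le : ∀ t, ∑ s ∈ Finset.range t, stopFactor c b s z * c (z s)
      ≤ ∑ s ∈ Finset.range t, c (z s) := fun t => Finset.sum_le_sum fun s _ => by
    unfold stopFactor; split_ifs <;> simp [hc]
  refine ⟨le t, ?_⟩
  induction t with
  | zero => simpa using hb
  | succ t ih =>
    by_cases ht : ∑ u ∈ Finset.range (t + 1), c (z u) ≤ b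
    · exact (le _).trans ht
    · rw [Finset.sum_range_succ, stopFactor, if_neg ht, zero_mul, add_zero]
      exact ih

/-- The tail of the martingale part at a single scale. -/
lemma IsReversible.pathExp_chainMartingale_le (hp : 1 < p) (hp2 : p ≤ 2)
    (hE : HasSmoothExpansion p B E) (hB : 1 ≤ B) (h : IsReversible π P)
    {d : Fin n → Fin n → ℝ} (hd : ∀ i j, 0 ≤ d i j) {g : Fin n → E}
    (hg : ∀ i j, ‖g j - g i‖ ≤ d i j) {μ l : ℝ} (hμ : 0 < μ) (hl : 0 < l)
    (hlμ : l ^ p = B * μ ^ p) (t : ℕ) :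
    μ ^ p * pathExp π P t (fun z => if 2 * l ≤ ‖chainMartingale P g t z‖ then 1 else 0)
      ≤ 8000 * pathExp π P t (fun z =>
        capSq (μ ^ p) (∑ s ∈ Finset.range t, stepMoment P d p (z s))
        + ∑ s ∈ Finset.range t, capSq (μ ^ p) (d (z s) (z (s + 1)) ^ p)) := by
  set b := μ ^ p with hb
  have hb0 : 0 < b := by positivity
  set c := stepMoment P d p with hc
  have hc0 : ∀ i, 0 ≤ c i := h.stepMoment_nonneg hd
  set χ := stopFactor c b with hχ
  set N : (ℕ → Fin n) → E := fun z =>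
    ∑ u ∈ Finset.range t, χ u z • truncDiff P d μ g (z u) (z (u + 1)) with hN
  set A : (ℕ → Fin n) → ℝ := fun z => ∑ s ∈ Finset.range t, c (z s) with hA
  set Q : (ℕ → Fin n) → ℝ := fun z =>
    ∑ s ∈ Finset.range t, capSq b (d (z s) (z (s + 1)) ^ p) with hQ
  have hQ0 : ∀ z, 0 ≤ Q z := fun z => Finset.sum_nonneg fun s _ => capSq_nonneg hb0 _
  have hχ01 : ∀ s z, χ s z = 0 ∨ χ s z = 1 := fun s z => by
    simp only [hχ, stopFactor]; split_ifs <;> simp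
  have hχ0 : ∀ s z, 0 ≤ χ s z := fun s z => by rcases hχ01 s z with e | e <;> simp [e]
  have hμl : μ ≤ l := by
    rw [← Real.rpow_le_rpow_iff hμ.le hl.le (by linarith : 0 < p), hlμ]
    nlinarith
  have moment := h.pathExp_norm_sum_le hp hE hB (truncDiff P d μ g)
    (h.sum_smul_truncDiff d μ g) χ hχ01 (by
      intro s z z' hz
      simp only [hχ, stopFactor]
      have : ∑ u ∈ Finset.range (s + 1), c (z u) = ∑ u ∈ Finset.range (s + 1), c (z' u) :=
        Finset.sum_congr rfl fun u hu => by
          have := Finset.mem_range.mp hu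
          rw [hz u (by omega)]
      rw [this]) t
  -- Either the accumulated moment reaches `b`, or some jump exceeds `μ`, or the stopped truncated
  -- martingale is within `μ ≤ l` of the original one. In the last case its norm is at least `l`,
  -- and Chebyshev's inequality applies since `l ^ p = B * b`.
  have tail : ∀ z, b * (if 2 * l ≤ ‖chainMartingale P g t z‖ then 1 else 0)
      ≤ capSq b (A z) + Q z + 1 / (B ^ 2 * b) * (‖N z‖ ^ p) ^ 2 := by
    intro z
    have n1 := capSq_nonneg hb0 (A z)
    have n2 := hQ0 z
    have n3 : 0 ≤ 1 / (B ^ 2 * b) * (‖N z‖ ^ p) ^ 2 := by positivity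
    split_ifs with hz
    swap
    · linarith
    by_cases h1 : b ≤ A z
    · rw [capSq_eq_of_le hb0 h1]; linarith
    push Not at h1
    by_cases h2 : ∃ s ∈ Finset.range t, μ < d (z s) (z (s + 1))
    · obtain ⟨s, hs, hsd⟩ := h2
      have : b ≤ Q z := by
        calc b = capSq b (d (z s) (z (s + 1)) ^ p) :=
              (capSq_eq_of_le hb0 (by rw [hb]; gcongr)).symm
          _ ≤ Q z := Finset.single_le_sum
              (f := fun s => capSq b (d (z s) (z (s + 1)) ^ p))
              (fun s _ => capSq_nonneg hb0 _) hs
      linarith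
    push Not at h2
    have hχ1 : ∀ s ∈ Finset.range t, χ s z = 1 := fun s hs => by
      simp only [hχ, stopFactor]
      refine if_pos (le_trans ?_ h1.le)
      refine Finset.sum_le_sum_of_subset_of_nonneg ?_ fun _ _ _ => hc0 _
      have := Finset.mem_range.mp hs
      exact Finset.range_subset_range.mpr (by omega)
    have hdiff : ‖chainMartingale P g t z - N z‖ ≤ μ := by
      rw [chainMartingale, hN, ← Finset.sum_sub_distrib]
      calc _ ≤ ∑ s ∈ Finset.range t, μ / μ ^ p * c (z s) := by
            refine (norm_sum_le _ _).trans (Finset.sum_le_sum fun s hs => ?_)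
            rw [hχ1 s hs, one_smul]
            exact h.norm_sub_truncDiff_le hp hd hg hμ (h2 s hs)
        _ = μ / b * A z := by rw [← Finset.mul_sum]
        _ ≤ μ / b * b := by gcongr
        _ = μ := by field_simp
    have hNl : l ≤ ‖N z‖ := by
      have := norm_sub_norm_le (chainMartingale P g t z) (N z)
      linarith
    have h3 : B * b ≤ ‖N z‖ ^ p := by rw [← hlμ]; gcongr
    have h4 : b ≤ 1 / (B ^ 2 * b) * (‖N z‖ ^ p) ^ 2 := by
      calc b = 1 / (B ^ 2 * b) * (B * b) ^ 2 := by field_simp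
        _ ≤ _ := by gcongr
    linarith
  -- The factor `B ^ 2` of the moment estimate cancels against the Chebyshev denominator. The
  -- constant is 100 · 8² + 20 · 32 = 7040.
  have bound : ∀ z, 1 / (B ^ 2 * b) *
      (100 * B ^ 2 * (∑ u ∈ Finset.range t,
          χ u z * ∑ j, P (z u) j * ‖truncDiff P d μ g (z u) j‖ ^ p) ^ 2
        + 20 * B ^ 2 *
          ∑ u ∈ Finset.range t, χ u z * (‖truncDiff P d μ g (z u) (z (u + 1))‖ ^ p) ^ 2)
      ≤ 7040 * (capSq b (A z) + Q z) := by
    intro z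
    set S := ∑ s ∈ Finset.range t, χ s z * c (z s) with hS
    have hS0 : 0 ≤ S := Finset.sum_nonneg fun s _ => mul_nonneg (hχ0 _ _) (hc0 _)
    obtain ⟨hSA, hSb⟩ := sum_stopFactor_mul_le hc0 hb0.le t z
    have hSq : S ^ 2 ≤ b * capSq b (A z) := sq_le_mul_capSq hb0 hS0 hSA hSb
    have b1 : ∑ u ∈ Finset.range t,
        χ u z * ∑ j, P (z u) j * ‖truncDiff P d μ g (z u) j‖ ^ p ≤ 8 * S := by
      rw [hS, Finset.mul_sum]
      refine Finset.sum_le_sum fun u _ => ?_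
      rw [mul_left_comm]
      exact mul_le_mul_of_nonneg_left (h.sum_norm_truncDiff_rpow_le hp hp2 hd hg μ _) (hχ0 _ _)
    have b0 : 0 ≤ ∑ u ∈ Finset.range t,
        χ u z * ∑ j, P (z u) j * ‖truncDiff P d μ g (z u) j‖ ^ p :=
      Finset.sum_nonneg fun u _ => mul_nonneg (hχ0 _ _) (Finset.sum_nonneg fun j _ =>
        mul_nonneg (h.transition_nonneg _ _) (by positivity))
    have b2 : ∑ u ∈ Finset.range t,
        χ u z * (‖truncDiff P d μ g (z u) (z (u + 1))‖ ^ p) ^ 2 ≤ 32 * (b * Q z) + 32 * S ^ 2 := by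
      calc _ ≤ ∑ u ∈ Finset.range t, (32 * (b * capSq b (d (z u) (z (u + 1)) ^ p))
            + 32 * (χ u z * c (z u)) ^ 2) := by
            refine Finset.sum_le_sum fun u _ => ?_
            have a1 := h.norm_truncDiff_rpow_le hp hp2 hd hg μ (z u) (z (u + 1))
            set τ := truncDist d μ (z u) (z (u + 1)) ^ p with hτ
            have τ0 := truncDist_nonneg hd μ (z u) (z (u + 1))
            have a0 : 0 ≤ ‖truncDiff P d μ g (z u) (z (u + 1))‖ ^ p := by positivity
            have a2 : τ ^ 2 ≤ b * capSq b (d (z u) (z (u + 1)) ^ p) :=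
              sq_le_mul_capSq hb0 (by positivity)
                (Real.rpow_le_rpow τ0 (truncDist_le hd μ _ _) (by linarith))
                (Real.rpow_le_rpow τ0 (truncDist_le' d hμ.le _ _) (by linarith))
            have a3 : (‖truncDiff P d μ g (z u) (z (u + 1))‖ ^ p) ^ 2
                ≤ (4 * (τ + c (z u))) ^ 2 := by gcongr
            have a4 := capSq_nonneg hb0 (d (z u) (z (u + 1)) ^ p)
            rcases hχ01 u z with e | e
            · rw [e]; nlinarith [mul_nonneg hb0.le a4]
            · rw [e]; nlinarith [sq_nonneg (τ - c (z u))]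
        _ = 32 * (b * Q z) + 32 * ∑ u ∈ Finset.range t, (χ u z * c (z u)) ^ 2 := by
            rw [Finset.sum_add_distrib, hQ, Finset.mul_sum, Finset.mul_sum, Finset.mul_sum]
        _ ≤ _ := by
            gcongr
            exact Finset.sum_sq_le_sq_sum_of_nonneg fun s _ => mul_nonneg (hχ0 _ _) (hc0 _)
    have n1 := capSq_nonneg hb0 (A z)
    have n2 := hQ0 z
    calc _ ≤ 1 / (B ^ 2 * b) * (100 * B ^ 2 * (8 * S) ^ 2
          + 20 * B ^ 2 * (32 * (b * Q z) + 32 * S ^ 2)) := by gcongr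
      _ = (1 / b) * (7040 * S ^ 2) + 640 * Q z := by field_simp; ring
      _ ≤ (1 / b) * (7040 * (b * capSq b (A z))) + 640 * Q z := by gcongr
      _ = 7040 * capSq b (A z) + 640 * Q z := by field_simp
      _ ≤ _ := by linarith
  calc b * pathExp π P t (fun z => if 2 * l ≤ ‖chainMartingale P g t z‖ then 1 else 0)
      ≤ pathExp π P t (fun z => (capSq b (A z) + Q z) + 1 / (B ^ 2 * b) * (‖N z‖ ^ p) ^ 2) := by
        rw [← pathExp_const_mul]; exact h.pathExp_mono tail
    _ = pathExp π P t (fun z => capSq b (A z) + Q z)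
        + 1 / (B ^ 2 * b) * pathExp π P t (fun z => (‖N z‖ ^ p) ^ 2) := by
        rw [pathExp_add, pathExp_const_mul]
    _ ≤ pathExp π P t (fun z => capSq b (A z) + Q z)
        + 7040 * pathExp π P t (fun z => capSq b (A z) + Q z) := by
        refine add_le_add le_rfl ((mul_le_mul_of_nonneg_left moment (by positivity)).trans ?_)
        rw [← pathExp_const_mul, ← pathExp_const_mul]
        exact h.pathExp_mono bound
    _ ≤ 8000 * pathExp π P t (fun z => capSq b (A z) + Q z) := by
        have : 0 ≤ pathExp π P t (fun z => capSq b (A z) + Q z) := by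
          have e := h.pathExp_mono (t := t) (G := fun _ => 0) fun z =>
            add_nonneg (capSq_nonneg hb0 (A z)) (hQ0 z)
          simpa [pathExp] using e
        linarith

end

/-! ### Summation over dyadic scales -/

/-- Relative to `a`, the two branches of the minimum are `(2 ^ k / r) ^ p` and `(r / 2 ^ k) ^ p`.
Bases at most 1 allow replacing the exponent `p` by 1, so the geometric decay away from `N` does not
depend on `p`. -/
lemma capSq_dyadic_le {p m a r : ℝ} (hp : 1 < p) (hm : 0 < m) (ha : 0 < a) (hr0 : 0 < r)
    (har : a = (m * r) ^ p) {N : ℤ} (hN1 : (2 : ℝ) ^ N ≤ r) (hN2 : r < 2 ^ (N + 1)) (k : ℤ) :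
    capSq ((m * (2 : ℝ) ^ k) ^ p) a ≤ 2 * a * ((1 : ℝ) / 2) ^ (k - N).natAbs := by
  have hk0 : (0 : ℝ) < 2 ^ k := by positivity
  rcases le_or_gt k N with hk | hk
  · have e : ((1 : ℝ) / 2) ^ (k - N).natAbs = 2 ^ k / 2 ^ N := by
      rw [one_div, inv_pow, ← zpow_natCast, ← zpow_neg, ← zpow_sub₀ two_ne_zero]
      congr 1; omega
    have h2 : (2 : ℝ) ^ k ≤ 2 ^ N := zpow_le_zpow_right₀ one_le_two hk
    calc capSq ((m * (2 : ℝ) ^ k) ^ p) a ≤ (m * (2 : ℝ) ^ k) ^ p := min_le_right _ _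
      _ = a * (2 ^ k / r) ^ p := by
        rw [har, ← Real.mul_rpow (by positivity) (by positivity)]
        congr 1; field_simp
      _ ≤ a * (2 ^ k / r) := by
        gcongr
        exact Real.rpow_le_self_of_le_one (by positivity)
          (by rw [div_le_one hr0]; exact h2.trans hN1) hp.le
      _ ≤ a * (2 ^ k / 2 ^ N) := by gcongr
      _ ≤ 2 * a * (2 ^ k / 2 ^ N) := by
        have : 0 ≤ a * ((2 : ℝ) ^ k / 2 ^ N) := by positivity
        linarith
      _ = _ := by rw [e]
  · have e : ((1 : ℝ) / 2) ^ (k - N).natAbs = 2 ^ N / 2 ^ k := by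
      rw [one_div, inv_pow, ← zpow_natCast, ← zpow_neg, ← zpow_sub₀ two_ne_zero]
      congr 1; omega
    have h2 : (2 : ℝ) ^ (N + 1) ≤ 2 ^ k := zpow_le_zpow_right₀ one_le_two (by omega)
    calc capSq ((m * (2 : ℝ) ^ k) ^ p) a ≤ a ^ 2 / (m * (2 : ℝ) ^ k) ^ p := min_le_left _ _
      _ = a * (r / 2 ^ k) ^ p := by
        have e2 : a = (m * 2 ^ k) ^ p * (r / 2 ^ k) ^ p := by
          rw [← Real.mul_rpow (by positivity) (by positivity), har]
          congr 1; field_simp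
        rw [div_eq_iff (by positivity), mul_assoc, mul_comm ((r / 2 ^ k) ^ p), ← e2, sq]
      _ ≤ a * (r / 2 ^ k) := by
        gcongr
        exact Real.rpow_le_self_of_le_one (by positivity)
          (by rw [div_le_one hk0]; exact hN2.le.trans h2) hp.le
      _ ≤ a * (2 ^ (N + 1) / 2 ^ k) := by gcongr
      _ = 2 * a * (2 ^ N / 2 ^ k) := by rw [zpow_add_one₀ two_ne_zero]; ring
      _ = _ := by rw [e]

lemma summable_half_pow_natAbs : Summable fun k : ℤ => ((1 : ℝ) / 2) ^ k.natAbs := by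
  rw [summable_int_iff_summable_nat_and_neg]
  constructor <;> simpa using summable_geometric_two

lemma sum_half_pow_natAbs_sub_le (N : ℤ) (F : Finset ℤ) :
    ∑ k ∈ F, ((1 : ℝ) / 2) ^ (k - N).natAbs ≤ ∑' k : ℤ, ((1 : ℝ) / 2) ^ k.natAbs := by
  have e := Finset.sum_map F (Equiv.subRight N).toEmbedding
    fun k : ℤ => ((1 : ℝ) / 2) ^ k.natAbs
  simp only [Equiv.coe_toEmbedding, Equiv.subRight_apply] at e
  rw [← e]
  exact summable_half_pow_natAbs.sum_le_tsum _ fun _ _ => by positivity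

/-- The sum of the truncated quadratic functions over dyadic scales is at most linear. -/
lemma sum_capSq_le {p m a : ℝ} (hp : 1 < p) (hm : 0 < m) (ha : 0 ≤ a) (F : Finset ℤ) :
    ∑ k ∈ F, capSq ((m * (2 : ℝ) ^ k) ^ p) a
      ≤ (2 * ∑' k : ℤ, ((1 : ℝ) / 2) ^ k.natAbs) * a := by
  rcases ha.eq_or_lt with rfl | ha
  · rw [mul_zero]
    refine Finset.sum_nonpos fun k _ => (min_le_left _ _).trans ?_
    simp
  have hr0 : 0 < a ^ (1 / p) / m := by positivity
  have har : a = (m * (a ^ (1 / p) / m)) ^ p := by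
    rw [mul_div_cancel₀ _ hm.ne', ← Real.rpow_mul ha.le, one_div,
      inv_mul_cancel₀ (by linarith), Real.rpow_one]
  obtain ⟨N, hN1, hN2⟩ := exists_mem_Ico_zpow hr0 (one_lt_two (α := ℝ))
  calc _ ≤ ∑ k ∈ F, 2 * a * ((1 : ℝ) / 2) ^ (k - N).natAbs := Finset.sum_le_sum fun k _ =>
        capSq_dyadic_le hp hm ha hr0 har hN1 hN2 k
    _ = 2 * a * ∑ k ∈ F, ((1 : ℝ) / 2) ^ (k - N).natAbs := by rw [Finset.mul_sum]
    _ ≤ 2 * a * ∑' k : ℤ, ((1 : ℝ) / 2) ^ k.natAbs :=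
        mul_le_mul_of_nonneg_left (sum_half_pow_natAbs_sub_le N F) (by positivity)
    _ = _ := by ring

lemma exists_sum_capSq_le : ∃ C : ℝ, 1 ≤ C ∧ ∀ p : ℝ, 1 < p → ∀ m : ℝ, 0 < m → ∀ a : ℝ, 0 ≤ a →
    ∀ F : Finset ℤ, ∑ k ∈ F, capSq ((m * (2 : ℝ) ^ k) ^ p) a ≤ C * a :=
  ⟨max 1 (2 * ∑' k : ℤ, ((1 : ℝ) / 2) ^ k.natAbs), le_max_left _ _, fun _ hp _ hm _ ha F =>
    (sum_capSq_le hp hm ha F).trans (mul_le_mul_of_nonneg_right (le_max_right _ _) ha)⟩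

/-! ### Forward-backward decomposition and the displacement at one scale -/

section

variable {E : Type*} [NormedAddCommGroup E] [NormedSpace ℝ E] {p B : ℝ} {n : ℕ} {π : Fin n → ℝ}
  {P : Matrix (Fin n) (Fin n) ℝ}

/-- The forward-backward martingale decomposition of `g (z t) - g (z 0)`. -/
lemma two_smul_sub_eq_chainMartingale (P : Matrix (Fin n) (Fin n) ℝ) (g : Fin n → E) (t : ℕ)
    (z : ℕ → Fin n) :
    (2 : ℝ) • (g (z t) - g (z 0)) = chainMartingale P g t z
      - chainMartingale P g t (fun s => z (t - s))
      + (g (z t) - ∑ k, P (z t) k • g k) - (g (z 0) - ∑ k, P (z 0) k • g k) := by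
  have hrev : chainMartingale P g t (fun s => z (t - s))
      = ∑ s ∈ Finset.range t, (g (z s) - ∑ k, P (z (s + 1)) k • g k) := by
    rw [chainMartingale, ← Finset.sum_range_reflect]
    refine Finset.sum_congr rfl fun s hs => ?_
    have := Finset.mem_range.mp hs
    have e1 : t - (t - 1 - s + 1) = s := by omega
    have e2 : t - (t - 1 - s) = s + 1 := by omega
    rw [e1, e2]
  have e1 := Finset.sum_range_sub (fun s => g (z s)) t
  have e2 := Finset.sum_range_sub (fun s => ∑ k, P (z s) k • g k) t
  -- Pairing the forward and backward increments over the same edge leaves the increments of `g` and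
  -- of its average under `P`, and both telescope.
  have e3 : chainMartingale P g t z - chainMartingale P g t (fun s => z (t - s))
      = (g (z t) - g (z 0)) + (∑ k, P (z t) k • g k - ∑ k, P (z 0) k • g k) := by
    rw [hrev, chainMartingale, ← e1, ← e2, ← Finset.sum_sub_distrib, ← Finset.sum_add_distrib]
    exact Finset.sum_congr rfl fun s _ => by abel
  rw [e3, two_smul]
  abel

/-- Jensen's inequality for the mean jump; it handles the boundary terms of the decomposition. -/
lemma IsReversible.norm_sub_sum_rpow_le (hp : 1 < p) (h : IsReversible π P)
    {d : Fin n → Fin n → ℝ} (hd : ∀ i j, 0 ≤ d i j) {g : Fin n → E}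
    (hg : ∀ i j, ‖g j - g i‖ ≤ d i j) (i : Fin n) :
    ‖g i - ∑ k, P i k • g k‖ ^ p ≤ stepMoment P d p i := by
  have e : g i - ∑ k, P i k • g k = -∑ k, P i k • (g k - g i) := by
    simp only [smul_sub, Finset.sum_sub_distrib, ← Finset.sum_smul, h.transition_sum, one_smul,
      neg_sub]
  have h2 : ‖g i - ∑ k, P i k • g k‖ ≤ ∑ k, P i k * d i k := by
    rw [e, norm_neg]
    refine (norm_sum_le _ _).trans (Finset.sum_le_sum fun k _ => ?_)
    rw [norm_smul, Real.norm_of_nonneg (h.transition_nonneg _ _)]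
    exact mul_le_mul_of_nonneg_left (hg i k) (h.transition_nonneg _ _)
  exact (Real.rpow_le_rpow (norm_nonneg _) h2 (by linarith)).trans
    (Real.rpow_arith_mean_le_arith_mean_rpow Finset.univ _ _
      (fun k _ => h.transition_nonneg i k) (h.transition_sum i) (fun k _ => hd i k) hp.le)

/-- The functional controlling the displacement of the chain at a single scale. -/
noncomputable def scaleFunctional (P : Matrix (Fin n) (Fin n) ℝ) (d : Fin n → Fin n → ℝ) (p : ℝ)
    (t : ℕ) (b : ℝ) (z : ℕ → Fin n) : ℝ :=
  16000 * (capSq b (∑ s ∈ Finset.range t, stepMoment P d p (z s))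
      + ∑ s ∈ Finset.range t, capSq b (d (z s) (z (s + 1)) ^ p))
    + capSq b (stepMoment P d p (z t)) + capSq b (stepMoment P d p (z 0))

/-- The tail of the displacement of the chain at a single scale. -/
lemma IsReversible.pathExp_tail_le (hp : 1 < p) (hp2 : p ≤ 2)
    (hE : HasSmoothExpansion p B E) (hB : 1 ≤ B) (h : IsReversible π P)
    {d : Fin n → Fin n → ℝ} (hd : ∀ i j, 0 ≤ d i j) {g : Fin n → E}
    (hg : ∀ i j, ‖g j - g i‖ ≤ d i j) {μ l τ : ℝ} (hμ : 0 < μ) (hl : 0 < l)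
    (hlμ : l ^ p = B * μ ^ p) (hgτ : ∀ i j, τ ≤ d i j → 4 * l ≤ ‖g i - g j‖) (t : ℕ) :
    μ ^ p * pathExp π P t (fun z => if τ ≤ d (z t) (z 0) then 1 else 0)
      ≤ pathExp π P t (scaleFunctional P d p t (μ ^ p)) := by
  set b := μ ^ p with hb
  have hb0 : 0 < b := by positivity
  have hlb : b ≤ (2 * l) ^ p := by
    calc b ≤ B * b := by nlinarith
      _ = l ^ p := hlμ.symm
      _ ≤ (2 * l) ^ p := by gcongr; linarith
  have hcap : ∀ i, 2 * l ≤ ‖g i - ∑ k, P i k • g k‖ → capSq b (stepMoment P d p i) = b := by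
    intro i hi
    refine capSq_eq_of_le hb0 (hlb.trans (le_trans ?_ (h.norm_sub_sum_rpow_le hp hd hg i)))
    gcongr
  set V : (ℕ → Fin n) → ℝ := fun z => if 2 * l ≤ ‖chainMartingale P g t z‖ then 1 else 0 with hV
  have hV0 : ∀ z, 0 ≤ V z := fun z => by simp only [hV]; split_ifs <;> norm_num
  have point : ∀ z, b * (if τ ≤ d (z t) (z 0) then 1 else 0)
      ≤ b * V z + b * V (fun s => z (t - s))
        + (capSq b (stepMoment P d p (z t)) + capSq b (stepMoment P d p (z 0))) := by
    intro z
    have n1 := capSq_nonneg hb0 (stepMoment P d p (z t))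
    have n2 := capSq_nonneg hb0 (stepMoment P d p (z 0))
    have n3 := mul_nonneg hb0.le (hV0 z)
    have n4 := mul_nonneg hb0.le (hV0 fun s => z (t - s))
    split_ifs with hz
    swap
    · linarith
    have h1 := hgτ _ _ hz
    have h2 := congrArg norm (two_smul_sub_eq_chainMartingale P g t z)
    rw [norm_smul, Real.norm_of_nonneg zero_le_two] at h2
    have h3 := norm_sub_le (chainMartingale P g t z - chainMartingale P g t (fun s => z (t - s))
      + (g (z t) - ∑ k, P (z t) k • g k)) (g (z 0) - ∑ k, P (z 0) k • g k)
    have h4 := norm_add_le (chainMartingale P g t z - chainMartingale P g t (fun s => z (t - s)))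
      (g (z t) - ∑ k, P (z t) k • g k)
    have h5 := norm_sub_le (chainMartingale P g t z) (chainMartingale P g t (fun s => z (t - s)))
    -- The doubled displacement has norm at least `8 * l`, so one of its four pieces has norm at
    -- least `2 * l`.
    by_cases c1 : 2 * l ≤ ‖chainMartingale P g t z‖
    · have : V z = 1 := if_pos c1
      rw [this]; linarith
    by_cases c2 : 2 * l ≤ ‖chainMartingale P g t (fun s => z (t - s))‖
    · have : V (fun s => z (t - s)) = 1 := if_pos c2
      rw [this]; linarith
    by_cases c3 : 2 * l ≤ ‖g (z t) - ∑ k, P (z t) k • g k‖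
    · rw [hcap _ c3]; linarith
    by_cases c4 : 2 * l ≤ ‖g (z 0) - ∑ k, P (z 0) k • g k‖
    · rw [hcap _ c4]; linarith
    linarith
  have hm := h.pathExp_chainMartingale_le hp hp2 hE hB hd hg hμ hl hlμ t
  calc _ ≤ pathExp π P t (fun z => b * V z + b * V (fun s => z (t - s))
        + (capSq b (stepMoment P d p (z t)) + capSq b (stepMoment P d p (z 0)))) := by
        rw [← pathExp_const_mul]; exact h.pathExp_mono point
    -- By reversibility the reversed martingale has the same tail as the forward one.
    _ = b * pathExp π P t V + b * pathExp π P t V + pathExp π P t (fun z =>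
        capSq b (stepMoment P d p (z t)) + capSq b (stepMoment P d p (z 0))) := by
        rw [pathExp_add, pathExp_add, pathExp_const_mul, pathExp_const_mul, h.pathExp_reverse]
    _ ≤ 16000 * pathExp π P t (fun z =>
          capSq b (∑ s ∈ Finset.range t, stepMoment P d p (z s))
          + ∑ s ∈ Finset.range t, capSq b (d (z s) (z (s + 1)) ^ p))
        + pathExp π P t (fun z =>
          capSq b (stepMoment P d p (z t)) + capSq b (stepMoment P d p (z 0))) := by
        linarith
    _ = pathExp π P t (scaleFunctional P d p t b) := by
        rw [← pathExp_const_mul, ← pathExp_add]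
        congr 1
        funext z
        rw [scaleFunctional, add_assoc]

/-- Summing the scale functionals over dyadic scales. -/
lemma IsReversible.sum_pathExp_scaleFunctional_le {C : ℝ} (h : IsReversible π P)
    {d : Fin n → Fin n → ℝ} (hd : ∀ i j, 0 ≤ d i j) {m : ℝ} {F : Finset ℤ}
    (hC : ∀ a : ℝ, 0 ≤ a → ∑ k ∈ F, capSq ((m * (2 : ℝ) ^ k) ^ p) a ≤ C * a) {t : ℕ} :
    ∑ k ∈ F, pathExp π P t (scaleFunctional P d p t ((m * (2 : ℝ) ^ k) ^ p))
      ≤ C * ((32000 * t + 2) * ∑ i, π i * stepMoment P d p i) := by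
  have hc0 := h.stepMoment_nonneg (p := p) hd
  set c := stepMoment P d p with hc
  calc _ = pathExp π P t (fun z =>
        ∑ k ∈ F, scaleFunctional P d p t ((m * (2 : ℝ) ^ k) ^ p) z) := (pathExp_sum _ _ _).symm
    _ ≤ pathExp π P t (fun z => C * (16000 * ((∑ s ∈ Finset.range t, c (z s))
          + ∑ s ∈ Finset.range t, d (z s) (z (s + 1)) ^ p) + c (z t) + c (z 0))) := by
        refine h.pathExp_mono fun z => ?_
        simp only [scaleFunctional, Finset.sum_add_distrib, ← Finset.mul_sum]
        rw [Finset.sum_comm]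
        have i1 := hC (∑ s ∈ Finset.range t, c (z s)) (Finset.sum_nonneg fun _ _ => hc0 _)
        have i2 : ∑ s ∈ Finset.range t, ∑ k ∈ F,
            capSq ((m * (2 : ℝ) ^ k) ^ p) (d (z s) (z (s + 1)) ^ p)
            ≤ C * ∑ s ∈ Finset.range t, d (z s) (z (s + 1)) ^ p := by
          rw [Finset.mul_sum]
          exact Finset.sum_le_sum fun s _ => hC _ (Real.rpow_nonneg (hd _ _) _)
        have i3 := hC (c (z t)) (hc0 _)
        have i4 := hC (c (z 0)) (hc0 _)
        linarith
    -- By stationarity each of the `2 * t` summed terms and the two boundary terms has the same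
    -- mean, the one-step moment; hence 16000 · 2t + 2.
    _ = _ := by
        rw [pathExp_const_mul, pathExp_add, pathExp_add, pathExp_const_mul, pathExp_add,
          pathExp_sum, pathExp_sum, h.pathExp_apply t c le_rfl, h.pathExp_apply t c (Nat.zero_le t),
          Finset.sum_congr rfl fun s hs =>
            h.pathExp_apply t c (Finset.mem_range.mp hs).le,
          Finset.sum_congr rfl fun s hs =>
            h.pathExp_apply_step t (fun i j => d i j ^ p) (Finset.mem_range.mp hs)]
        simp only [Finset.sum_const, Finset.card_range, nsmul_eq_mul]
        have : ∑ i, π i * ∑ j, P i j * d i j ^ p = ∑ i, π i * c i := rfl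
        rw [this]
        ring

end

/-! ### Threshold embeddings and assembly of the scales -/

/-- The infimum is attained, because each difference quotient is a lower bound for every admissible
constant. -/
lemma lipschitzWith_lipConst {X Y : Type*} [MetricSpace X] [MetricSpace Y] {f : X → Y}
    (hf : ∃ L : ℝ≥0, LipschitzWith L f) : LipschitzWith (lipConst f) f := by
  refine LipschitzWith.of_dist_le_mul fun x y => ?_
  by_cases hxy : x = y
  · simp [hxy]
  have hpos : 0 < dist x y := dist_pos.mpr hxy
  rw [← div_le_iff₀ hpos]
  obtain ⟨q, hq⟩ : ∃ q : ℝ≥0, (q : ℝ) = dist (f x) (f y) / dist x y :=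
    ⟨⟨_, by positivity⟩, rfl⟩
  rw [← hq, NNReal.coe_le_coe]
  refine le_csInf hf fun L hL => ?_
  rw [← NNReal.coe_le_coe, hq]
  exact (div_le_iff₀ hpos).mpr (hL.dist_le_mul x y)

/-- Threshold embeddings into a normed space can be normalized to be `1`-Lipschitz. -/
lemma ThresholdEmbedsWith.exists_map {K : ℝ} {X E : Type*} [MetricSpace X]
    [NormedAddCommGroup E] [NormedSpace ℝ E] (h : ThresholdEmbedsWith K X E) {τ : ℝ} (hτ : 0 < τ) :
    ∃ g : X → E, (∀ x y, ‖g y - g x‖ ≤ dist x y) ∧ ∀ x y, τ ≤ dist x y → τ / K ≤ ‖g x - g y‖ := by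
  obtain ⟨hK, φ, hφ⟩ := h
  obtain ⟨hL, hτφ⟩ := hφ τ hτ
  by_cases hex : ∃ x y : X, τ ≤ dist x y
  · obtain ⟨x₀, y₀, h₀⟩ := hex
    have hpos : (0 : ℝ) < lipConst (φ τ) := by exact_mod_cast (hτφ x₀ y₀ h₀).1
    have hnorm : ∀ x y, ‖(lipConst (φ τ) : ℝ)⁻¹ • φ τ x - (lipConst (φ τ) : ℝ)⁻¹ • φ τ y‖
        = dist (φ τ x) (φ τ y) / lipConst (φ τ) := fun x y => by
      rw [← smul_sub, norm_smul, norm_inv, Real.norm_of_nonneg hpos.le, ← dist_eq_norm,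
        inv_mul_eq_div]
    refine ⟨fun x => (lipConst (φ τ) : ℝ)⁻¹ • φ τ x, fun x y => ?_, fun x y hxy => ?_⟩
    · rw [hnorm, div_le_iff₀ hpos, mul_comm, dist_comm x y]
      exact (lipschitzWith_lipConst hL).dist_le_mul y x
    · rw [hnorm, le_div_iff₀ hpos]
      calc τ / K * lipConst (φ τ) = lipConst (φ τ) / K * τ := by ring
        _ ≤ _ := (hτφ x y hxy).2
  · push Not at hex
    exact ⟨fun _ => 0, fun x y => by simp, fun x y hxy => absurd hxy (not_le.mpr (hex x y))⟩

/-- This settles the zero space, where admissible smoothness constants have no positive lower bound.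
-/
lemma ThresholdEmbedsWith.dist_eq_zero {K : ℝ} {X E : Type*} [MetricSpace X]
    [NormedAddCommGroup E] [NormedSpace ℝ E] [Subsingleton E] (h : ThresholdEmbedsWith K X E)
    (x y : X) : dist x y = 0 := by
  by_contra hne
  have hpos : 0 < dist x y := lt_of_le_of_ne dist_nonneg (Ne.symm hne)
  obtain ⟨g, -, hg⟩ := h.exists_map hpos
  have h1 := hg x y le_rfl
  rw [Subsingleton.elim (g x - g y) 0, norm_zero] at h1
  have h2 : 0 < dist x y / K := div_pos hpos h.1
  linarith

/-- A nonnegative number taking finitely many values is dominated by its dyadic layers. -/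
lemma exists_finset_rpow_le_sum {n : ℕ} {d : Fin n → Fin n → ℝ} (hd : ∀ i j, 0 ≤ d i j) {p : ℝ}
    (hp : 1 < p) (hp2 : p ≤ 2) : ∃ F : Finset ℤ, ∀ i j,
    d i j ^ p ≤ 4 * ∑ k ∈ F, ((2 : ℝ) ^ k) ^ p * (if (2 : ℝ) ^ k ≤ d i j then 1 else 0) := by
  have hex : ∀ q : Fin n × Fin n, ∃ k : ℤ, 0 < d q.1 q.2 →
      d q.1 q.2 ∈ Set.Ico ((2 : ℝ) ^ k) (2 ^ (k + 1)) := fun q => by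
    by_cases hq : 0 < d q.1 q.2
    · obtain ⟨k, hk⟩ := exists_mem_Ico_zpow hq (one_lt_two (α := ℝ))
      exact ⟨k, fun _ => hk⟩
    · exact ⟨0, fun h => absurd h hq⟩
  choose κ hκ using hex
  refine ⟨Finset.univ.image κ, fun i j => ?_⟩
  have hnn : ∀ k : ℤ, 0 ≤ ((2 : ℝ) ^ k) ^ p * (if (2 : ℝ) ^ k ≤ d i j then 1 else 0) := fun k => by
    split_ifs <;> positivity
  rcases (hd i j).eq_or_lt with h0 | h0
  · have e : d i j ^ p = 0 := by rw [← h0, Real.zero_rpow (by linarith)]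
    rw [e]
    exact mul_nonneg (by norm_num) (Finset.sum_nonneg fun k _ => hnn k)
  obtain ⟨h1, h2⟩ := hκ (i, j) h0
  calc d i j ^ p ≤ (2 * 2 ^ κ (i, j)) ^ p := by
        rw [zpow_add_one₀ two_ne_zero] at h2
        gcongr
        linarith
    _ = 2 ^ p * ((2 : ℝ) ^ κ (i, j)) ^ p := Real.mul_rpow (by norm_num) (by positivity)
    _ ≤ 2 ^ (2 : ℝ) * ((2 : ℝ) ^ κ (i, j)) ^ p := by gcongr; norm_num
    _ = 4 * (((2 : ℝ) ^ κ (i, j)) ^ p * (if (2 : ℝ) ^ κ (i, j) ≤ d i j then 1 else 0)) := by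
        rw [if_pos h1]; norm_num
    _ ≤ _ := by
        gcongr
        exact Finset.single_le_sum
          (f := fun k => ((2 : ℝ) ^ k) ^ p * (if (2 : ℝ) ^ k ≤ d i j then 1 else 0))
          (fun k _ => hnn k) (Finset.mem_image_of_mem κ (Finset.mem_univ _))

/-- Threshold embeddability into a space with smooth expansions gives the displacement bound. -/
lemma ThresholdEmbedsWith.pathExp_dist_le {C : ℝ} (hC1 : 1 ≤ C)
    (hC : ∀ p : ℝ, 1 < p → ∀ m : ℝ, 0 < m → ∀ a : ℝ, 0 ≤ a →
      ∀ F : Finset ℤ, ∑ k ∈ F, capSq ((m * (2 : ℝ) ^ k) ^ p) a ≤ C * a)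
    {E : Type*} [NormedAddCommGroup E] [NormedSpace ℝ E] {p B : ℝ} (hp : 1 < p) (hp2 : p ≤ 2)
    (hE : HasSmoothExpansion p B E) (hB : 1 ≤ B) {X : Type*} [MetricSpace X] {K : ℝ}
    (hX : ThresholdEmbedsWith K X E) {n : ℕ} {π : Fin n → ℝ} {P : Matrix (Fin n) (Fin n) ℝ}
    (h : IsReversible π P) (f : Fin n → X) {t : ℕ} (ht : 1 ≤ t) :
    pathExp π P t (fun z => dist (f (z t)) (f (z 0)) ^ p)
      ≤ 160000 * C * (B * (4 * K) ^ p) * t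
        * ∑ i, π i * ∑ j, P i j * dist (f i) (f j) ^ p := by
  have hK := hX.1
  set d : Fin n → Fin n → ℝ := fun i j => dist (f i) (f j) with hd
  have hd0 : ∀ i j, 0 ≤ d i j := fun _ _ => dist_nonneg
  set T := ∑ i, π i * ∑ j, P i j * d i j ^ p with hT
  have hT0 : 0 ≤ T := Finset.sum_nonneg fun i _ => mul_nonneg (h.initial_nonneg i)
    (h.stepMoment_nonneg hd0 i)
  obtain ⟨F, hF⟩ := exists_finset_rpow_le_sum hd0 hp hp2
  -- The separation `2 ^ k / K` must equal `4 * l`, and `l ^ p = B * μ ^ p`; solving gives `μ = m *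
  -- 2 ^ k`.
  set m := 1 / (4 * K * B ^ (1 / p)) with hm
  have hB0 : 0 < B := by linarith
  have hm0 : 0 < m := by positivity
  set D := B * (4 * K) ^ p with hD
  have hD0 : 0 < D := by positivity
  have hBp : (B ^ (1 / p)) ^ p = B := by
    rw [← Real.rpow_mul hB0.le, one_div, inv_mul_cancel₀ (by linarith), Real.rpow_one]
  have escale : ∀ k : ℤ, ((2 : ℝ) ^ k) ^ p = D * (m * 2 ^ k) ^ p := fun k => by
    rw [hD]
    nth_rewrite 1 [← hBp]
    rw [← Real.mul_rpow (by positivity) (by positivity),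
      ← Real.mul_rpow (by positivity) (by positivity), hm]
    congr 1
    field_simp
  -- The map `g` changes with `k`, but the functional on the right does not see it.
  have scale : ∀ k : ℤ, (m * 2 ^ k) ^ p * pathExp π P t (fun z =>
      if (2 : ℝ) ^ k ≤ d (z t) (z 0) then 1 else 0)
      ≤ pathExp π P t (scaleFunctional P d p t ((m * 2 ^ k) ^ p)) := fun k => by
    have h2k : (0 : ℝ) < 2 ^ k := by positivity
    obtain ⟨g, hg1, hg2⟩ := hX.exists_map h2k
    refine h.pathExp_tail_le hp hp2 hE hB hd0 (g := g ∘ f) (fun i j => hg1 (f i) (f j))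
      (μ := m * 2 ^ k) (l := 2 ^ k / (4 * K)) (by positivity) (by positivity) ?_ ?_ t
    · rw [Real.div_rpow h2k.le (by positivity), escale, hD]
      field_simp
    · intro i j hij
      calc 4 * ((2 : ℝ) ^ k / (4 * K)) = 2 ^ k / K := by field_simp
        _ ≤ _ := hg2 _ _ hij
  have ht' : (1 : ℝ) ≤ t := by exact_mod_cast ht
  calc pathExp π P t (fun z => d (z t) (z 0) ^ p)
      ≤ pathExp π P t (fun z => 4 * ∑ k ∈ F, ((2 : ℝ) ^ k) ^ p *
          (if (2 : ℝ) ^ k ≤ d (z t) (z 0) then 1 else 0)) := h.pathExp_mono fun z => hF _ _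
    _ = 4 * ∑ k ∈ F, ((2 : ℝ) ^ k) ^ p * pathExp π P t (fun z =>
          if (2 : ℝ) ^ k ≤ d (z t) (z 0) then 1 else 0) := by
        rw [pathExp_const_mul, pathExp_sum]
        simp only [pathExp_const_mul]
    _ = 4 * D * ∑ k ∈ F, (m * 2 ^ k) ^ p * pathExp π P t (fun z =>
          if (2 : ℝ) ^ k ≤ d (z t) (z 0) then 1 else 0) := by
        rw [mul_assoc, Finset.mul_sum _ _ D]
        simp only [escale, mul_assoc]
    _ ≤ 4 * D * ∑ k ∈ F, pathExp π P t (scaleFunctional P d p t ((m * 2 ^ k) ^ p)) := by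
        gcongr with k _
        exact scale k
    _ ≤ 4 * D * (C * ((32000 * t + 2) * T)) := by
        gcongr
        exact h.sum_pathExp_scaleFunctional_le hd0 fun a ha => hC p hp m hm0 a ha F
    -- The additive 2 is absorbed because `t ≥ 1`.
    _ ≤ 4 * D * (C * ((40000 * t) * T)) := by gcongr; linarith
    _ = _ := by ring

/-- The quantitative form of the main theorem, for an arbitrary admissible smoothness constant. -/
lemma exists_markovTypeIneq_of_thresholdEmbedsWith : ∃ C : ℝ, 0 < C ∧
    ∀ (p : ℝ), 1 < p → p ≤ 2 → ∀ (E : Type*) [NormedAddCommGroup E] [NormedSpace ℝ E] (S : ℝ),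
      0 < S → (∀ ε : ℝ, 0 < ε → smoothnessModulus E ε ≤ S ^ p * ε ^ p) →
    ∀ (X : Type*) [MetricSpace X] (K : ℝ), ThresholdEmbedsWith K X E →
      MarkovTypeIneq p X (C * (K * S)) := by
  obtain ⟨C, hC1, hC⟩ := exists_sum_capSq_le
  refine ⟨160000 * 24 * C * 4, by positivity, ?_⟩
  intro p hp hp2 E _ _ S hS hsm X _ K hX n Ω _ μ _ π P Z hZ f t
  have h := hZ.isReversible
  have hK := hX.1
  rcases subsingleton_or_nontrivial E with hE | hE
  · simp [hX.dist_eq_zero, Real.zero_rpow (by linarith : p ≠ 0)]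
  rcases Nat.eq_zero_or_pos t with rfl | ht
  · simp [Real.zero_rpow (by linarith : p ≠ 0)]
  have hS4 := one_fourth_le_of_smoothnessModulus_le hp2 hS hsm
  have hexp := hasSmoothExpansion_of_smoothnessModulus_le hp hp2 hS4 hsm
  have key := hX.pathExp_dist_le hC1 hC hp hp2 hexp (by linarith) h f ht
  rw [hZ.integral_eq_pathExp t (fun z => dist (f (z t)) (f (z 0)) ^ p) fun z z' hz => by
      rw [hz t le_rfl, hz 0 (Nat.zero_le t)],
    hZ.integral_eq_pathExp 1 (fun z => dist (f (z 0)) (f (z 1)) ^ p) fun z z' hz => by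
      rw [hz 0 (Nat.zero_le 1), hz 1 le_rfl],
    h.pathExp_apply_step 1 (fun i j => dist (f i) (f j) ^ p) zero_lt_one]
  refine key.trans ?_
  have hT0 : 0 ≤ ∑ i, π i * ∑ j, P i j * dist (f i) (f j) ^ p :=
    Finset.sum_nonneg fun i _ => mul_nonneg (h.initial_nonneg i)
      (h.stepMoment_nonneg (d := fun i j => dist (f i) (f j)) (fun _ _ => dist_nonneg) i)
  gcongr
  -- A constant at least 1 is bounded by its `p`-th power, so it moves inside without depending on
  -- `p`.
  have hc : (1 : ℝ) ≤ 160000 * 24 * C := by linarith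
  calc 160000 * C * (24 * S ^ p * (4 * K) ^ p) = 160000 * 24 * C * (4 * K * S) ^ p := by
        rw [Real.mul_rpow (x := 4 * K) (by positivity) hS.le]; ring
    _ ≤ (160000 * 24 * C) ^ p * (4 * K * S) ^ p := by
        gcongr
        exact Real.self_le_rpow_of_one_le hc hp.le
    _ = (160000 * 24 * C * 4 * (K * S)) ^ p := by
        rw [← Real.mul_rpow (by positivity) (by positivity)]
        congr 1; ring

lemma markovTypeConst_le {p M : ℝ} {X : Type*} [MetricSpace X] (hM : 0 < M)
    (h : MarkovTypeIneq p X M) : markovTypeConst p X ≤ M :=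
  csInf_le ⟨0, fun _ hx => hx.1.le⟩ ⟨hM, h⟩

/-- The parallelogram law gives the sum of the squared norms, and `a ≤ (a ^ 2 + 1) / 2` turns it
into a bound on the norms. Hence a Hilbert space admits the constant 1 for `p = 2`. -/
lemma smoothnessModulus_le_sq (H : Type*) [NormedAddCommGroup H] [InnerProductSpace ℝ H] {ε : ℝ}
    (hε : 0 < ε) : smoothnessModulus H ε ≤ ε ^ (2 : ℝ) := by
  rw [Real.rpow_two]
  refine Real.sSup_le ?_ (sq_nonneg ε)
  rintro r ⟨x, y, hx, hy, rfl⟩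
  have h := parallelogram_law_with_norm ℝ x (ε • y)
  rw [norm_smul, hx, hy, Real.norm_of_nonneg hε.le] at h
  nlinarith [sq_nonneg (‖x + ε • y‖ - 1), sq_nonneg (‖x - ε • y‖ - 1)]

theorem mainTheorem1 :
    (∃ C : ℝ, 0 < C ∧
      ∀ (p : ℝ), 1 < p → p ≤ 2 →
      ∀ (Z : Type*) [NormedAddCommGroup Z] [NormedSpace ℝ Z] [CompleteSpace Z],
        IsPUniformlySmooth p Z →
      ∀ (X : Type*) [MetricSpace X],
        (ThresholdEmbeds X Z → HasMarkovType p X) ∧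
        ∀ D : ℝ, ThresholdEmbedsWith D X Z →
          markovTypeConst p X ≤ C * (D * smoothnessConst p Z)) ∧
    (∃ C : ℝ, 0 < C ∧
      ∀ (H : Type*) [NormedAddCommGroup H] [InnerProductSpace ℝ H] [CompleteSpace H]
        (X : Type*) [MetricSpace X],
        (ThresholdEmbeds X H → HasMarkovType 2 X) ∧
        ∀ K : ℝ, ThresholdEmbedsWith K X H →
          markovTypeConst 2 X ≤ C * K) := by
  constructor
  · obtain ⟨C, hC0, hC⟩ := exists_markovTypeIneq_of_thresholdEmbedsWith
    refine ⟨C, hC0, ?_⟩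
    intro p hp hp2 Z _ _ _ hZ X _
    refine ⟨?_, ?_⟩
    · rintro ⟨K, hX⟩
      obtain ⟨S, hS, hsm⟩ := hZ
      have hK := hX.1
      exact ⟨C * (K * S), by positivity, hC p hp hp2 Z S hS hsm X K hX⟩
    · intro D hX
      have hD := hX.1
      -- The bound holds for every admissible `S` with the same `C`, so it passes to the infimum.
      rw [← mul_assoc, ← div_le_iff₀' (by positivity)]
      refine le_csInf hZ fun S hS => ?_
      rw [div_le_iff₀' (by positivity), mul_assoc]
      have hS0 := hS.1
      exact markovTypeConst_le (by positivity) (hC p hp hp2 Z S hS.1 hS.2 X D hX)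
  · obtain ⟨C, hC0, hC⟩ := exists_markovTypeIneq_of_thresholdEmbedsWith
    refine ⟨C, hC0, ?_⟩
    intro H _ _ _ X _
    have main : ∀ K : ℝ, ThresholdEmbedsWith K X H → MarkovTypeIneq 2 X (C * K) := fun K hX => by
      have := hC 2 one_lt_two le_rfl H 1 one_pos (fun ε hε => by
        rw [Real.one_rpow, one_mul]; exact smoothnessModulus_le_sq H hε) X K hX
      rwa [mul_one] at this
    refine ⟨?_, fun K hX => markovTypeConst_le (mul_pos hC0 hX.1) (main K hX)⟩
    rintro ⟨K, hX⟩
    exact ⟨C * K, mul_pos hC0 hX.1, main K hX⟩
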